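/- A decision problem consists of a set of instances, encoded as binary words, and a set of yes-instances. It is in NP if there are a polynomial $q$ and a verifier, running in polynomial time on pairs (instance, binary certificate), such that an instance $x$ is a yes-instance if and only if the verifier accepts $(x,y)$ for some certificate $y$ of length at most $q(|x|)$. It is NP-complete if it is in NP and every language $L \subseteq \{0,1\}^*$ in NP reduces to it, i.e. there is a polynomial-time computable map from $\{0,1\}^*$ to its set of instances that sends exactly the elements of $L$ to yes-instances. Polynomial time refers to multi-stack (equivalently, multi-tape) Turing machines. BDR (Bipartite Degree Realization) is the following decision problem. Instance: a finite sequence $D=(d_1,\dots,d_n)$ of nonnegative integers, encoded as $1^{d_1}0\,1^{d_2}0\cdots 1^{d_n}0$. Question: is there a simple bipartite graph on $n$ vertices whose degrees are exactly $d_1,\dots,d_n$? For real constants $c_1,c_2$, $\mathrm{BDR}_{c_1,c_2}$ is the restriction of BDR to those instances $D=(d_1,\dots,d_n)$ in which $c_1 n\le d_i\le c_2 n$ for all $i$ (only such sequences are instances). **Theorem.** If BDR is NP-complete, then $\mathrm{BDR}_{c_1,c_2}$ is also NP-complete for all real numbers $c_1,c_2$ with $0<c_2<\frac12$ and $c_1<1-c_2-\sqrt{1-2c_2}$.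 -/

import Mathlib

namespace DegreeRealization

/-- A decision problem: a type of instances, an (injective) encoding of the instances by binary
words, and the set of yes-instances. -/
structure DecisionProblem where
  Instance : Type
  encode : Instance → List Bool
  encode_injective : Function.Injective encode
  yes : Set Instance

/-- The decision problem of membership in a language of binary words. -/
def languageProblem (L : Set (List Bool)) : DecisionProblem where
  Instance := List Bool
  encode := id
  encode_injective := Function.injective_id
  yes := L

/-- `f` is computed by some (multi-stack) Turing machine in time polynomial in the length of the
encoded input. -/
def PolyTimeComputable {α β Γ Γ' : Type} (ea : α → List Γ) (eb : β → List Γ') (f : α → β) : Prop :=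
  Nonempty (Turing.TM2ComputableInPolyTime ea eb f)

/-- Encoding of an instance `x` together with a certificate `y`, as the word `x # y` over the
alphabet `{0, 1, #}`; the separator `#` is `none`. -/
def encodeWithCertificate {α : Type} (e : α → List Bool) (p : α × List Bool) :
    List (Option Bool) :=
  (e p.1).map some ++ none :: p.2.map some

/-- The class NP: the yes-instances are those that have a certificate, of length polynomial in the
size of the instance, which is accepted by a polynomial-time verifier. -/
def DecisionProblem.InNP (P : DecisionProblem) : Prop :=
  ∃ (verify : P.Instance × List Bool → Bool) (q : Polynomial ℕ),
    PolyTimeComputable (encodeWithCertificate P.encode) Computability.encodeBool verify ∧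
    ∀ x : P.Instance, x ∈ P.yes ↔
      ∃ y : List Bool, y.length ≤ q.eval (P.encode x).length ∧ verify (x, y) = true

/-- Polynomial-time many-one (Karp) reducibility: a polynomial-time computable map from the
instances of `P` to the instances of `Q` that preserves and reflects yes-instances. -/
def DecisionProblem.PolyReduces (P Q : DecisionProblem) : Prop :=
  ∃ f : P.Instance → Q.Instance,
    PolyTimeComputable P.encode Q.encode f ∧ ∀ x : P.Instance, x ∈ P.yes ↔ f x ∈ Q.yes

/-- Every language in NP reduces to `P` in polynomial time. -/
def DecisionProblem.NPHard (P : DecisionProblem) : Prop :=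
  ∀ L : Set (List Bool), (languageProblem L).InNP → (languageProblem L).PolyReduces P

def DecisionProblem.NPComplete (P : DecisionProblem) : Prop :=
  P.InNP ∧ P.NPHard

/-- The sequence `D = (d₁, …, dₙ)` has a bipartite realization: there is a simple bipartite graph
on `n` vertices whose degrees are exactly `d₁, …, dₙ`. -/
def HasBipartiteRealization (D : List ℕ) : Prop :=
  ∃ (G : SimpleGraph (Fin D.length)) (_ : DecidableRel G.Adj),
    G.IsBipartite ∧ ∀ i, G.degree i = D.get i

/-- The binary word `1^d₁ 0 1^d₂ 0 … 1^dₙ 0` that encodes `(d₁, …, dₙ)`. Unary notation is adequate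
since the degrees of a graph are smaller than its number `n` of vertices. -/
def encodeSequence (D : List ℕ) : List Bool :=
  D.flatMap fun d => List.replicate d true ++ [false]

theorem encodeSequence_injective : Function.Injective encodeSequence := by
  have key : ∀ (a b : ℕ) (l m : List Bool),
      List.replicate a true ++ false :: l = List.replicate b true ++ false :: m →
        a = b ∧ l = m := by
    intro a
    induction a with
    | zero => intro b l m h; cases b <;> simp_all [List.replicate_succ]
    | succ a ih =>
      intro b l m h
      cases b with
      | zero => simp [List.replicate_succ] at h
      | succ b =>
        simp only [List.replicate_succ, List.cons_append, List.cons.injEq, true_and] at h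
        have := ih b l m h
        exact ⟨by omega, this.2⟩
  intro D
  induction D with
  | nil => intro E h; cases E <;> simp_all [encodeSequence]
  | cons d D ih =>
    intro E h
    cases E with
    | nil => simp [encodeSequence] at h
    | cons e E =>
      simp only [encodeSequence, List.flatMap_cons, List.append_assoc, List.singleton_append] at h
      obtain ⟨h1, h2⟩ := key _ _ _ _ h
      rw [h1, ih h2]

/-- The Bipartite Degree Realization problem: the instances are the finite sequences of nonnegative
integers. -/
def BDR : DecisionProblem where
  Instance := List ℕ
  encode := encodeSequence
  encode_injective := encodeSequence_injective
  yes := {D | HasBipartiteRealization D}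

/-- The restriction of `BDR` to those sequences in which all the degrees are between `c₁ n` and
`c₂ n`, where `n` is the length of the sequence. -/
def BDRBetween (c₁ c₂ : ℝ) : DecisionProblem where
  Instance := {D : List ℕ // ∀ d ∈ D, c₁ * D.length ≤ d ∧ d ≤ c₂ * D.length}
  encode := fun D => encodeSequence D.1
  encode_injective := encodeSequence_injective.comp Subtype.val_injective
  yes := {D | HasBipartiteRealization D.1}

end DegreeRealization

/-!
Membership in NP is inherited from BDR: the same verifier serves. For hardness, a polynomial-time
reduction to BDR is followed by the map `amplify`, which embeds a sequence `D` in a long sequence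
with all terms in the prescribed range, and which preserves and reflects realizability.

*The combinatorial map.* Let `m` be the length of the encoding of `D`. Zeros are added to `D` until
it has `2m` terms; a realization of `D` extends to one with sides of size `m` each. Every vertex is
then joined to the `h` vertices of a set `H` on the opposite side (one such set for each side), the
two sets `H` are joined completely to each other, and each is joined to a set `W` of `v` vertices on
the opposite side by a biregular graph with degrees `g` and `b`. This shifts the `2m` degrees to
`d + h` and creates `2h` vertices of degree `h + m + g` and `2v` of degree `b`, where `hg = vb`
(`Realizes.gadget`, `exists_biregular`).

*Why it is rigid.* The sequence does not record which vertices lie on which side, so an arbitrary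
realization could split them unevenly (`Realizes.of_gadget`). Suppose one side has `h + δ` of the
high vertices and `m + ε` of the original ones. The edges at high vertices can only be as numerous
as their degrees require if `δ (δ + ε) ≤ 0`, hence `|δ| ≤ m`. On the other hand `h`, `g`, `b` are
chosen to be multiples of a number `k > 2m² + m`, so the equality of the degree sums of the two
sides says, modulo `k`, that `2δm` is a difference `σ` of two sums of terms of `D`, and `|σ| ≤ m`.
As `|2δm - σ| < k`, the congruence is an equality, and `2|δ|m ≤ m` gives `δ = 0`. Then the count is
tight: high vertices are adjacent to all opposite high and original vertices, low vertices to high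
ones only, and the original vertices induce a realization of `D`.

*The constants.* With `s = √(1 - 2c₂)` one has `c₂ = (1 - s²)/2`, and the bound on `c₁` is
`(1 - s)²/2`. For `s = p/q` and `o = q - p`, taking `h : v : g : b = oq : pq : op : o²` makes the
number of vertices close to `2q²k`, the largest degree close to `(q² - p²)k` and the smallest one
`o²k`. A rational number slightly larger than `s` leaves room for the terms of lower order
(`exists_constants`, `exists_amplify_between`).

*Polynomial time.* The encoding of `amplify o p K D` is produced from that of `D` by loops over the
input, nested to depth four. Structured stack programs `Prog`, their compilation `Prog.code` to
multi-stack machines, and the predicate `Emits` make this precise, and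
`PolyTimeComputable.comp_emits` attaches such a program to the end of the given machine. The output
of that machine has polynomial length because each step pushes a bounded number of symbols.
-/

namespace DegreeRealization

open Finset

/-! ### Bipartite realizations on arbitrary finite vertex types -/

open scoped Classical in
/-- The relation `R` on the finite type `V` is the adjacency relation of a bipartite graph, with
sides given by the colouring `c`, in which each vertex `x` has degree `d x`. -/
def Realizes {V : Type} [Fintype V] (d : V → ℕ) (c : V → Bool) (R : V → V → Prop) : Prop :=
  (∀ x y, R x y → R y x) ∧ (∀ x y, R x y → c x ≠ c y) ∧ ∀ x, #{y | R x y} = d x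

theorem hasBipartiteRealization_iff_realizes (D : List ℕ) :
    HasBipartiteRealization D ↔ ∃ c R, Realizes D.get c R := by
  classical
  constructor
  · rintro ⟨G, hdec, ⟨C⟩, hdeg⟩
    refine ⟨fun x => C x = 0, G.Adj, fun x y h => h.symm, fun x y h => ?_, fun x => ?_⟩
    · have := C.valid h
      simp only [ne_eq, decide_eq_decide]
      omega
    · rw [← hdeg x, ← SimpleGraph.card_neighborFinset_eq_degree]
      congr 1
      ext y
      simp
  · rintro ⟨c, R, hs, hc, hd⟩
    let G : SimpleGraph (Fin D.length) :=
      { Adj := R, symm := ⟨fun x y h => hs x y h⟩, loopless := ⟨fun x h => hc x x h rfl⟩ }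
    refine ⟨G, Classical.decRel _, ⟨SimpleGraph.Coloring.mk (fun x => if c x then 0 else 1) ?_⟩, ?_⟩
    · intro x y h
      have := hc x y h
      cases hx : c x <;> cases hy : c y <;> simp_all
    · intro x
      rw [← hd x, ← SimpleGraph.card_neighborFinset_eq_degree]
      congr 1
      ext y
      simp [G]

/-- Two functions with the same multiset of values differ by a bijection of their domains. -/
theorem exists_equiv_of_map_univ_eq {V W : Type} [Fintype V] [Fintype W] {f : V → ℕ} {g : W → ℕ}
    (h : univ.val.map f = univ.val.map g) : ∃ e : V ≃ W, ∀ x, g (e x) = f x := by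
  classical
  have key : ∀ n, Nonempty ({v // f v = n} ≃ {w // g w = n}) := by
    intro n
    rw [← Fintype.card_eq, Fintype.card_subtype, Fintype.card_subtype]
    have := congrArg (Multiset.count n) h
    rw [Multiset.count_map, Multiset.count_map] at this
    simpa only [eq_comm (a := n), Finset.card_def, Finset.filter_val] using this
  let e : V ≃ W := (Equiv.sigmaFiberEquiv f).symm.trans
    ((Equiv.sigmaCongrRight fun n => (key n).some).trans (Equiv.sigmaFiberEquiv g))
  exact ⟨e, fun x => ((key (f x)).some ⟨x, rfl⟩).2⟩

theorem Realizes.comp_equiv {V W : Type} [Fintype V] [Fintype W] {d : W → ℕ} {c : W → Bool}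
    {R : W → W → Prop} (h : Realizes d c R) (e : V ≃ W) :
    Realizes (fun x => d (e x)) (fun x => c (e x)) (fun x y => R (e x) (e y)) := by
  classical
  refine ⟨fun x y => h.1 _ _, fun x y => h.2.1 _ _, fun x => ?_⟩
  refine Eq.trans ?_ (h.2.2 (e x))
  exact Finset.card_equiv e (by simp)

/-- Whether a sequence is realizable can be decided on any vertex type on which the degrees form
the same multiset. -/
theorem hasBipartiteRealization_iff_of_map_eq {V : Type} [Fintype V] {d : V → ℕ} {D : List ℕ}
    (h : univ.val.map d = (D : Multiset ℕ)) :
    HasBipartiteRealization D ↔ ∃ c R, Realizes d c R := by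
  rw [hasBipartiteRealization_iff_realizes]
  have h' : univ.val.map d = univ.val.map D.get := by
    rw [h, Fin.univ_val_map, List.ofFn_get]
  obtain ⟨e, he⟩ := exists_equiv_of_map_univ_eq h'
  constructor
  · rintro ⟨c, R, hr⟩
    have := hr.comp_equiv e
    simp only [he] at this
    exact ⟨_, _, this⟩
  · rintro ⟨c, R, hr⟩
    have := hr.comp_equiv e.symm
    simp only [← he, Equiv.apply_symm_apply] at this
    exact ⟨_, _, this⟩

/-- Vertices of degree zero may be discarded. -/
theorem Realizes.of_embedding {V W : Type} [Fintype V] [Fintype W] {d : W → ℕ} {c : W → Bool}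
    {R : W → W → Prop} (h : Realizes d c R) (e : V ↪ W) (h0 : ∀ w ∉ Set.range e, d w = 0) :
    Realizes (fun x => d (e x)) (fun x => c (e x)) (fun x y => R (e x) (e y)) := by
  classical
  refine ⟨fun x y => h.1 _ _, fun x y => h.2.1 _ _, fun x => ?_⟩
  refine Eq.trans ?_ (h.2.2 (e x))
  rw [← Finset.card_map e]
  congr 1
  ext w
  simp only [mem_map, mem_filter, mem_univ, true_and]
  constructor
  · rintro ⟨y, hy, rfl⟩
    exact hy
  · intro hw
    by_contra hcon
    have hw' : w ∉ Set.range e := by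
      rintro ⟨y, rfl⟩
      exact hcon ⟨y, hw, rfl⟩
    have := h.2.2 w
    rw [h0 w hw', Finset.card_eq_zero] at this
    have hmem : e x ∈ ({y | R w y} : Finset W) := by simpa using h.1 _ _ hw
    rw [this] at hmem
    simp at hmem

/-- Vertices of degree zero may be added, and if there are enough of them the two sides can be
made equally large. -/
theorem Realizes.exists_balanced {V W : Type} [Fintype V] [Fintype W] {d : W → ℕ} {c : V → Bool}
    {R : V → V → Prop} (e : V ↪ W) (h : Realizes (fun x => d (e x)) c R)
    (h0 : ∀ w ∉ Set.range e, d w = 0) {m : ℕ} (hV : Fintype.card V ≤ m)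
    (hW : Fintype.card W = 2 * m) :
    ∃ c' R', Realizes d c' R' ∧ ∀ b, #{w | c' w = b} = m := by
  classical
  obtain ⟨T, h1, h2, h3⟩ := exists_subsuperset_card_eq (n := m)
    (s := ({v | c v = true} : Finset V).map e) (t := (({v | c v = false} : Finset V).map e)ᶜ)
    (by
      intro w hw
      simp only [mem_map, mem_filter, mem_univ, true_and, mem_compl, not_exists, not_and] at hw ⊢
      obtain ⟨v, hv, rfl⟩ := hw
      intro v' hv' heq
      rw [e.injective heq, hv] at hv'
      cases hv')
    (by
      rw [card_map]
      exact (card_le_univ _).trans hV)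
    (by
      rw [card_compl, card_map, hW]
      have := card_le_univ ({v | c v = false} : Finset V)
      omega)
  have hT : ∀ v, decide (e v ∈ T) = c v := by
    intro v
    cases hv : c v
    · have := mt (@h2 (e v)) (by simpa using hv)
      simpa using this
    · simpa using h1 (by simpa using hv : e v ∈ _)
  refine ⟨fun w => decide (w ∈ T), fun w w' => ∃ v v', e v = w ∧ e v' = w' ∧ R v v',
    ⟨?_, ?_, ?_⟩, ?_⟩
  · rintro _ _ ⟨v, v', rfl, rfl, hr⟩
    exact ⟨v', v, rfl, rfl, h.1 _ _ hr⟩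
  · rintro _ _ ⟨v, v', rfl, rfl, hr⟩
    simp only [hT]
    exact h.2.1 _ _ hr
  · intro w
    by_cases hw : w ∈ Set.range e
    · obtain ⟨v, rfl⟩ := hw
      refine Eq.trans ?_ (h.2.2 v)
      rw [← Finset.card_map e]
      congr 1
      ext w
      simp only [mem_map, mem_filter, mem_univ, true_and]
      constructor
      · rintro ⟨u, u', hu, rfl, hr⟩
        rw [e.injective hu] at hr
        exact ⟨u', hr, rfl⟩
      · rintro ⟨u, hr, rfl⟩
        exact ⟨v, u, rfl, rfl, hr⟩
    · rw [h0 w hw]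
      refine Finset.card_eq_zero.2 (Finset.eq_empty_of_forall_notMem fun w' hw' => ?_)
      simp only [mem_filter, mem_univ, true_and] at hw'
      obtain ⟨v, v', rfl, -, -⟩ := hw'
      exact hw ⟨v, rfl⟩
  · intro b
    cases b
    · have : ({w | decide (w ∈ T) = false} : Finset W) = Tᶜ := by ext; simp
      rw [this, card_compl, hW, h3]
      omega
    · simpa using h3

end DegreeRealization

namespace DegreeRealization

open Finset

/-! ### Forcing an equitable bipartition -/

theorem sum_comp_bool {V : Type} [Fintype V] (c : V → Bool) (F : Bool → ℕ) :
    ∑ x, F (c x) = #{x | c x = true} * F true + #{x | c x = false} * F false := by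
  simp only [Finset.card_filter, Finset.sum_mul, ← Finset.sum_add_distrib]
  refine Finset.sum_congr rfl fun x _ => ?_
  cases c x <;> simp

theorem card_true_add_card_false {V : Type} [Fintype V] (c : V → Bool) :
    #{x | c x = true} + #{x | c x = false} = Fintype.card V := by
  have := sum_comp_bool c (fun _ => 1)
  simpa using this.symm

/-- The degrees on either side of a bipartite graph have the same sum. -/
theorem Realizes.sum_true_eq_sum_false {V : Type} [Fintype V] {d : V → ℕ} {c : V → Bool}
    {R : V → V → Prop} (h : Realizes d c R) :
    ∑ x, (if c x then d x else 0) = ∑ x, (if c x then 0 else d x) := by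
  classical
  obtain ⟨hs, hc, hd⟩ := h
  have h1 : ∀ x, d x = ∑ y, if R x y then 1 else 0 := fun x => by
    rw [← hd x, Finset.card_filter]
  have h2 : ∀ x, (if c x then d x else 0) = ∑ y, if c x then (if R x y then 1 else 0) else 0 := by
    intro x; rw [h1]; split_ifs <;> simp
  have h3 : ∀ x, (if c x then 0 else d x) = ∑ y, if c x then 0 else (if R x y then 1 else 0) := by
    intro x; rw [h1]; split_ifs <;> simp
  simp only [h2, h3]
  rw [Finset.sum_comm]
  refine Finset.sum_congr rfl fun y _ => Finset.sum_congr rfl fun x _ => ?_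
  by_cases hr : R x y
  · have := hc x y hr
    have hr' := hs x y hr
    cases hx : c x <;> cases hy : c y <;> simp_all
  · have hr' : ¬ R y x := fun h => hr (hs _ _ h)
    simp [hr, hr']

/-- The degrees after adding to the vertices `M`, of degrees `d`, a set `P` of vertices of high
degree `A` and a set `Q` of vertices of low degree `b`. All degrees in `M` go up by `h`. -/
def gadgetDegree {M P Q : Type} (d : M → ℕ) (h A b : ℕ) : M ⊕ P ⊕ Q → ℕ :=
  Sum.elim (fun x => d x + h) (Sum.elim (fun _ => A) (fun _ => b))

/-- The sign condition `hle` bounds `|δ|` by `|ε| ≤ m`, so `s + 2 * δ * m` is smaller than its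
divisor `N` and vanishes; but `|2 * δ * m|` is either `0` or larger than `|s|`. -/
theorem eq_zero_of_dvd_of_mul_nonpos {δ ε m s N : ℤ} (hm : 0 < m) (hε : |ε| ≤ m) (hs : |s| ≤ m)
    (hN : 2 * m * m + m < N) (hle : δ * (δ + ε) ≤ 0) (hdvd : N ∣ s + 2 * δ * m) : δ = 0 := by
  have hδ : |δ| ≤ m := by
    rw [abs_le] at hε ⊢
    constructor <;> nlinarith
  have h0 : s + 2 * δ * m = 0 := by
    apply Int.eq_zero_of_abs_lt_dvd hdvd
    calc |s + 2 * δ * m| ≤ |s| + |2 * δ * m| := abs_add_le _ _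
      _ = |s| + 2 * |δ| * m := by rw [abs_mul, abs_mul, abs_of_pos hm]; norm_num
      _ ≤ m + 2 * m * m := by gcongr
      _ < N := by linarith
  by_contra hne
  have h1 : 1 ≤ |δ| := Int.one_le_abs hne
  have h2 : |s| = 2 * |δ| * m := by
    rw [eq_neg_of_add_eq_zero_left h0, abs_neg, abs_mul, abs_mul, abs_of_pos hm]; norm_num
  nlinarith

/-- If `p₁` of the `2 * h` high vertices lie on one side, the handshake identity `hbal` and the
count `hcount` of the edges at high vertices force `p₁ = h`: all degrees but `h + m + g` and those
in `s₁`, `s₂` are multiples of the large number `N`. -/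
theorem eq_of_balance_of_count {h m g b N x₁ x₂ p₁ p₂ q₁ q₂ s₁ s₂ : ℕ} (hm : 0 < m)
    (hN : 2 * m * m + m < N) (hNh : N ∣ h) (hNg : N ∣ g) (hNb : N ∣ b) (hx : x₁ + x₂ = 2 * m)
    (hp : p₁ + p₂ = 2 * h) (hs : s₁ + s₂ ≤ m)
    (hbal : s₁ + x₁ * h + (p₁ * (h + m + g) + q₁ * b) =
      s₂ + x₂ * h + (p₂ * (h + m + g) + q₂ * b))
    (hcount : 2 * h * h + 2 * h * m ≤ p₁ * x₂ + p₂ * x₁ + (p₁ * p₂ + p₂ * p₁)) : p₁ = h := by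
  have key : (p₁ : ℤ) - h = 0 := by
    apply eq_zero_of_dvd_of_mul_nonpos (ε := x₁ - m) (m := m) (s := (s₁ : ℤ) - s₂) (N := N)
    · exact_mod_cast hm
    · rw [abs_le]; omega
    · rw [abs_le]; omega
    · exact_mod_cast hN
    · zify at hx hp hcount
      have e1 : (x₂ : ℤ) = 2 * m - x₁ := by linarith
      have e2 : (p₂ : ℤ) = 2 * h - p₁ := by linarith
      rw [e1, e2] at hcount
      nlinarith
    · obtain ⟨h', rfl⟩ := hNh
      obtain ⟨g', rfl⟩ := hNg
      obtain ⟨b', rfl⟩ := hNb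
      zify at hbal hp ⊢
      refine ⟨-((x₁ - x₂) * h' + (p₁ - p₂) * (h' + g') + (q₁ - q₂) * b'), ?_⟩
      linear_combination hbal + (m : ℤ) * hp
  omega

theorem sum_true_const {V : Type} [Fintype V] (c : V → Bool) (k : ℕ) :
    ∑ x, (if c x then k else 0) = #{x | c x = true} * k := by
  simpa using sum_comp_bool c (fun s => if s then k else 0)

theorem sum_false_const {V : Type} [Fintype V] (c : V → Bool) (k : ℕ) :
    ∑ x, (if c x then 0 else k) = #{x | c x = false} * k := by
  simpa using sum_comp_bool c (fun s => if s then 0 else k)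

theorem sum_true_add_const {V : Type} [Fintype V] (c : V → Bool) (d : V → ℕ) (k : ℕ) :
    ∑ x, (if c x then d x + k else 0) =
      ∑ x, (if c x = true then d x else 0) + #{x | c x = true} * k := by
  rw [← sum_true_const, ← Finset.sum_add_distrib]
  exact Finset.sum_congr rfl fun x _ => by cases c x <;> simp

theorem sum_false_add_const {V : Type} [Fintype V] (c : V → Bool) (d : V → ℕ) (k : ℕ) :
    ∑ x, (if c x then 0 else d x + k) =
      ∑ x, (if c x = false then d x else 0) + #{x | c x = false} * k := by
  rw [← sum_false_const, ← Finset.sum_add_distrib]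
  exact Finset.sum_congr rfl fun x _ => by cases c x <;> simp

theorem card_filter_sum {X Y : Type} [Fintype X] [Fintype Y] (r : X ⊕ Y → Prop) [DecidablePred r]
    [DecidablePred fun x => r (.inl x)] [DecidablePred fun y => r (.inr y)] :
    #{z | r z} = #{x | r (.inl x)} + #{y | r (.inr y)} := by
  rw [Finset.card_filter, Finset.card_filter, Finset.card_filter, Fintype.sum_sum_type]
  congr!

/-- Every realization of the enlarged degree sequence restricts to a realization of `d` on `M`: high
vertices are equally divided between the sides, and this leaves room only for the edges that join
high vertices to all high vertices and all vertices of `M` opposite to them. -/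
theorem Realizes.of_gadget {M P Q : Type} [Fintype M] [Fintype P] [Fintype Q] {d : M → ℕ}
    {h m g v b N : ℕ} (hm : 0 < m) (hP : Fintype.card P = 2 * h) (hQ : Fintype.card Q = 2 * v)
    (hM : Fintype.card M = 2 * m) (hgb : h * g = v * b) (hNh : N ∣ h) (hNg : N ∣ g) (hNb : N ∣ b)
    (hN : 2 * m * m + m < N) (hd : ∑ x, d x ≤ m) {c : M ⊕ P ⊕ Q → Bool}
    {R : M ⊕ P ⊕ Q → M ⊕ P ⊕ Q → Prop} (hR : Realizes (gadgetDegree d h (h + m + g) b) c R) :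
    Realizes d (fun x => c (.inl x)) (fun x y => R (.inl x) (.inl y)) := by
  classical
  have hbal := hR.sum_true_eq_sum_false
  obtain ⟨hs, hc, hdeg⟩ := hR
  let nM : M ⊕ P ⊕ Q → ℕ := fun u => #{x : M | R u (.inl x)}
  let nP : M ⊕ P ⊕ Q → ℕ := fun u => #{x : P | R u (.inr (.inl x))}
  let nQ : M ⊕ P ⊕ Q → ℕ := fun u => #{x : Q | R u (.inr (.inr x))}
  let cM : M → Bool := fun x => c (.inl x)
  let cP : P → Bool := fun x => c (.inr (.inl x))
  let cQ : Q → Bool := fun x => c (.inr (.inr x))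
  have hdeg' : ∀ u, nM u + nP u + nQ u = gadgetDegree d h (h + m + g) b u := by
    intro u
    rw [← hdeg u]
    simp only [nM, nP, nQ, Finset.card_filter, Fintype.sum_sum_type, add_assoc]
  have cross : ∀ {X Y : Type} [Fintype X] [Fintype Y] (r : X → Y → Prop),
      ∑ x, #{y | r x y} = ∑ y, #{x | r x y} := by
    intro X Y _ _ r
    simp only [Finset.card_filter]
    exact Finset.sum_comm
  have hsymm : ∀ u w, R u w ↔ R w u := fun u w => ⟨hs u w, hs w u⟩
  have hopp : ∀ {u w}, R u w → c w = !c u := by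
    intro u w hr
    have := hc u w hr
    cases hu : c u <;> cases hw : c w <;> simp_all
  -- the number of vertices of either colour
  let x : Bool → ℕ := fun s => #{y : M | cM y = s}
  let p : Bool → ℕ := fun s => #{y : P | cP y = s}
  let q : Bool → ℕ := fun s => #{y : Q | cQ y = s}
  have hx : x true + x false = 2 * m := hM ▸ card_true_add_card_false cM
  have hp : p true + p false = 2 * h := hP ▸ card_true_add_card_false cP
  have hMle : ∀ u : P, nM (.inr (.inl u)) ≤ x (!cP u) := fun u =>
    card_le_card fun y hy => by simpa [cM, cP] using hopp (by simpa using hy)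
  have hPle : ∀ u : P, nP (.inr (.inl u)) ≤ p (!cP u) := fun u =>
    card_le_card fun y hy => by simpa [cM, cP] using hopp (by simpa using hy)
  have hQle : ∀ w : Q, nP (.inr (.inr w)) ≤ b := fun w => by
    have := hdeg' (.inr (.inr w))
    simp only [gadgetDegree, Sum.elim_inr] at this
    omega
  have hPQ : ∑ u : P, nQ (.inr (.inl u)) = ∑ w : Q, nP (.inr (.inr w)) := by
    simp only [nQ, nP]
    rw [cross]
    simp only [hsymm (.inr (.inr _))]
  have hPsum : ∑ u : P, nM (.inr (.inl u)) + ∑ u : P, nP (.inr (.inl u)) +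
      ∑ w : Q, nP (.inr (.inr w)) = 2 * h * (h + m + g) := by
    rw [← hPQ, ← Finset.sum_add_distrib, ← Finset.sum_add_distrib]
    simp only [hdeg', gadgetDegree, Sum.elim_inr, Sum.elim_inl, sum_const, card_univ, hP,
      smul_eq_mul]
  have hM_sum := Finset.sum_le_sum fun u (_ : u ∈ univ) => hMle u
  have hP_sum := Finset.sum_le_sum fun u (_ : u ∈ univ) => hPle u
  have hQ_sum := Finset.sum_le_sum fun u (_ : u ∈ univ) => hQle u
  have hMx : ∑ u, x (!cP u) = p true * x false + p false * x true :=
    sum_comp_bool cP (fun s => x (!s))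
  have hPp : ∑ u, p (!cP u) = p true * p false + p false * p true :=
    sum_comp_bool cP (fun s => p (!s))
  have hQb : ∑ _w : Q, b = 2 * v * b := by simp [hQ]
  rw [hMx] at hM_sum
  rw [hPp] at hP_sum
  rw [hQb] at hQ_sum
  have hvb : 2 * v * b = 2 * h * g := by rw [mul_assoc, ← hgb, mul_assoc]
  -- both colours occur equally often among the vertices of high degree
  have hph : p true = h := by
    let sM : Bool → ℕ := fun s => ∑ y : M, if cM y = s then d y else 0
    have hsM : sM true + sM false = ∑ y, d y := by
      simp only [sM, ← Finset.sum_add_distrib]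
      refine Finset.sum_congr rfl fun y _ => ?_
      cases cM y <;> simp
    have hbal' : sM true + x true * h + (p true * (h + m + g) + q true * b) =
        sM false + x false * h + (p false * (h + m + g) + q false * b) := by
      simp only [Fintype.sum_sum_type, gadgetDegree, Sum.elim_inl, Sum.elim_inr] at hbal
      have e1 := sum_true_add_const cM d h
      have e2 := sum_false_add_const cM d h
      have e3 := sum_true_const cP (h + m + g)
      have e4 := sum_false_const cP (h + m + g)
      have e5 := sum_true_const cQ b
      have e6 := sum_false_const cQ b
      simp only [cM, cP, cQ] at e1 e2 e3 e4 e5 e6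
      rw [e1, e2, e3, e4, e5, e6] at hbal
      exact hbal
    exact eq_of_balance_of_count hm hN hNh hNg hNb hx hp (hsM ▸ hd) hbal' (by
      have e3 : 2 * h * (h + m + g) = 2 * h * h + 2 * h * m + 2 * h * g := by ring
      omega)
  have hpb : ∀ s, p s = h := by
    intro s; cases s <;> omega
  -- hence the counting inequalities are equalities, and every term attains its bound
  have hpf := hpb false
  have e1 : p true * x false + p false * x true = 2 * h * m := by
    rw [hph, hpf, ← mul_add, add_comm, hx]; ring
  have e2 : p true * p false + p false * p true = 2 * h * h := by
    rw [hph, hpf]; ring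
  have e3 : 2 * h * (h + m + g) = 2 * h * h + 2 * h * m + 2 * h * g := by ring
  have tightM : ∀ u : P, nM (.inr (.inl u)) = x (!cP u) := by
    have := (Finset.sum_eq_sum_iff_of_le fun u (_ : u ∈ univ) => hMle u).1 (by omega)
    exact fun u => this u (mem_univ _)
  have tightQ : ∀ w : Q, nP (.inr (.inr w)) = b := by
    have := (Finset.sum_eq_sum_iff_of_le fun u (_ : u ∈ univ) => hQle u).1 (by omega)
    exact fun u => this u (mem_univ _)
  have adjPM : ∀ (u : P) (y : M), cP u = (!cM y) → R (.inr (.inl u)) (.inl y) := by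
    intro u y huy
    have hsub : ({y : M | R (.inr (.inl u)) (.inl y)} : Finset M) ⊆
        ({y : M | cM y = !cP u} : Finset M) :=
      fun y hy => by simpa [cM, cP] using hopp (by simpa using hy)
    have heq := eq_of_subset_of_card_le hsub (tightM u).ge
    have : y ∈ ({y : M | cM y = !cP u} : Finset M) := by simp [huy]
    rw [← heq] at this
    simpa using this
  have hnP : ∀ y : M, nP (.inl y) = h := by
    intro y
    rw [← hpb (!cM y)]
    simp only [nP, p]
    congr 1
    ext u
    simp only [mem_filter, mem_univ, true_and]
    exact ⟨fun hr => hopp hr, fun hr => hs _ _ (adjPM u y hr)⟩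
  have hnQ : ∀ y : M, nQ (.inl y) = 0 := by
    intro y
    refine card_eq_zero.2 (filter_eq_empty_iff.2 fun w _ hr => ?_)
    have h1 := hdeg' (.inr (.inr w))
    simp only [gadgetDegree, Sum.elim_inr, tightQ] at h1
    have h2 : nM (.inr (.inr w)) = 0 := by omega
    exact filter_eq_empty_iff.1 (card_eq_zero.1 h2) (mem_univ y) (hs _ _ hr)
  refine ⟨fun _ _ => hs _ _, fun _ _ => hc _ _, fun y => ?_⟩
  have := hdeg' (.inl y)
  rw [hnP, hnQ] at this
  simp only [gadgetDegree, Sum.elim_inl] at this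
  refine Eq.trans ?_ (show nM (.inl y) = d y by omega)
  simp only [nM]

/-- A balanced realization of `d` extends to the enlarged degree sequence: high vertices are joined
to all opposite vertices of `M`, to all opposite high vertices, and to the opposite low vertices by
the biregular relation `B`. The first component of a new vertex is its side. -/
theorem Realizes.gadget {M H W : Type} [Fintype M] [Fintype H] [Fintype W] {d : M → ℕ}
    {h m g b : ℕ} (hH : Fintype.card H = h) {c : M → Bool} {R : M → M → Prop}
    (hR : Realizes d c R) (hc : ∀ s, #{x | c x = s} = m) {B : H → W → Prop}
    [∀ i j, Decidable (B i j)] (hBg : ∀ i, #{j | B i j} = g) (hBb : ∀ j, #{i | B i j} = b) :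
    ∃ c' R', Realizes (gadgetDegree (P := Bool × H) (Q := Bool × W) d h (h + m + g) b) c' R' := by
  classical
  obtain ⟨hs, hcol, hdeg⟩ := hR
  let c' : M ⊕ (Bool × H) ⊕ (Bool × W) → Bool := Sum.elim c (Sum.elim Prod.fst Prod.fst)
  let r : M ⊕ (Bool × H) ⊕ (Bool × W) → M ⊕ (Bool × H) ⊕ (Bool × W) → Prop
    | .inl x, .inl y => R x y
    | .inl _, .inr (.inl _) => True
    | .inr (.inl _), .inl _ => True
    | .inr (.inl _), .inr (.inl _) => True
    | .inr (.inl u), .inr (.inr w) => B u.2 w.2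
    | .inr (.inr w), .inr (.inl u) => B u.2 w.2
    | _, _ => False
  have hprod : ∀ {X : Type} [Fintype X] (s : Bool) (f : X → Prop) [DecidablePred f]
      [DecidablePred fun y : Bool × X => s ≠ y.1 ∧ f y.2],
      #{y : Bool × X | s ≠ y.1 ∧ f y.2} = #{y | f y} := by
    intro X _ s f _ _
    simp only [Finset.card_filter, Fintype.sum_prod_type, Fintype.sum_bool]
    cases s <;> simp
  refine ⟨c', fun x y => c' x ≠ c' y ∧ r x y, ?_, fun _ _ hr => hr.1, ?_⟩
  · rintro (x | u | w) (x' | u' | w') ⟨h1, h2⟩ <;> refine ⟨h1.symm, ?_⟩ <;>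
      first | exact h2 | exact hs _ _ h2
  · rintro (x | u | w)
    · have e1 : #{y : M | c x ≠ c y ∧ R x y} = d x := by
        refine Eq.trans ?_ (hdeg x)
        congr 1
        ext y
        simpa using hcol x y
      have e2 : #{y : Bool × H | c x ≠ y.1 ∧ True} = h := by
        rw [hprod (c x) (fun _ : H => True)]
        simpa using hH
      have e3 : #{y : Bool × W | c x ≠ y.1 ∧ False} = 0 := by simp
      rw [card_filter_sum, card_filter_sum]
      exact congrArg₂ _ e1 (congrArg₂ _ e2 e3)
    · have e1 : #{y : M | u.1 ≠ c y ∧ True} = m := by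
        refine Eq.trans ?_ (hc (!u.1))
        congr 1
        ext y
        cases u.1 <;> cases c y <;> simp
      have e2 : #{y : Bool × H | u.1 ≠ y.1 ∧ True} = h := by
        rw [hprod u.1 (fun _ : H => True)]
        simpa using hH
      have e3 := (hprod u.1 (fun w : W => B u.2 w)).trans (hBg u.2)
      rw [card_filter_sum, card_filter_sum]
      exact (congrArg₂ _ e1 (congrArg₂ _ e2 e3)).trans
        (by simp only [gadgetDegree, Sum.elim_inr, Sum.elim_inl]; omega)
    · have e1 : #{y : M | w.1 ≠ c y ∧ False} = 0 := by simp
      have e2 := (hprod w.1 (fun u : H => B u w.2)).trans (hBb w.2)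
      have e3 : #{y : Bool × W | w.1 ≠ y.1 ∧ False} = 0 := by simp
      rw [card_filter_sum, card_filter_sum]
      exact (congrArg₂ _ e1 (congrArg₂ _ e2 e3)).trans
        (by simp only [gadgetDegree, Sum.elim_inr]; omega)

/-- The circulant relation between `o * (q * k)` and `p * (q * k)` vertices, in which two vertices
are related if the residue modulo `q` of the first minus that of the second is one of
`0, …, o - 1`, is biregular. -/
theorem exists_biregular {o p q k : ℕ} [NeZero q] (ho : o ≤ q) :
    ∃ (B : Fin o × Fin k × ZMod q → Fin p × Fin k × ZMod q → Prop) (_ : ∀ i j, Decidable (B i j)),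
      (∀ i, #{j | B i j} = o * p * k) ∧ ∀ j, #{i | B i j} = o * o * k := by
  classical
  have h0 : #{x : ZMod q | x.val < o} = o := by
    refine (Fintype.card_subtype _).symm.trans
      ((Fintype.card_congr (β := Fin o) ?_).trans (Fintype.card_fin o))
    refine ⟨fun x => ⟨x.1.val, x.2⟩, fun i => ⟨(i : ℕ), ?_⟩, fun x => ?_,
      fun i => ?_⟩
    · rw [ZMod.val_natCast_of_lt (i.2.trans_le ho)]
      exact i.2
    · simp
    · ext
      exact ZMod.val_natCast_of_lt (i.2.trans_le ho)
  have key : ∀ {n : ℕ} (f : ZMod q ≃ ZMod q), #{j : Fin n × Fin k × ZMod q | (f j.2.2).val < o} =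
      o * n * k := by
    intro n f
    have : #{x : ZMod q | (f x).val < o} = o := by
      refine Eq.trans ?_ h0
      exact Finset.card_equiv f (by simp)
    rw [Finset.card_filter] at this ⊢
    simp only [Fintype.sum_prod_type, this]
    simp
    ring
  refine ⟨fun i j => (i.2.2 - j.2.2).val < o, inferInstance, fun i => ?_, fun j => ?_⟩
  · exact key (Equiv.subLeft i.2.2)
  · exact key (Equiv.subRight j.2.2)

end DegreeRealization

namespace DegreeRealization

open Finset

/-! ### The amplified sequence -/

theorem encodeSequence_length (D : List ℕ) : (encodeSequence D).length = D.length + D.sum := by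
  induction D with
  | nil => rfl
  | cons d D ih =>
    simp only [encodeSequence, List.flatMap_cons, List.length_append, List.length_replicate,
      List.length_cons, List.length_nil, List.sum_cons] at ih ⊢
    omega

/-- The sequence to which `D` is reduced, for constants `o`, `p`, `K`. With `m` the length of the
encoding of `D`, `k = K m²` and `q = o + p`, zeros are added to `D` to obtain `2m` terms, all of
which are raised by `h = oqk`, and `2h` high terms `h + m + opk` and `2pqk` low terms `o²k` are
adjoined. -/
def amplify (o p K : ℕ) (D : List ℕ) : List ℕ :=
  let m := D.length + D.sum
  let k := K * m ^ 2
  let h := o * (o + p) * k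
  D.map (· + h) ++ List.replicate (D.length + 2 * D.sum) h ++
    List.replicate (2 * h) (h + m + o * p * k) ++
    List.replicate (2 * (p * (o + p) * k)) (o * o * k)

theorem amplify_length (o p K : ℕ) (D : List ℕ) : (amplify o p K D).length =
    2 * ((o + p) ^ 2 * (K * (D.length + D.sum) ^ 2) + (D.length + D.sum)) := by
  simp only [amplify, List.length_append, List.length_map, List.length_replicate]
  ring

theorem map_univ_gadgetDegree {X Y P Q : Type} [Fintype X] [Fintype Y] [Fintype P] [Fintype Q]
    (d : X → ℕ) (h A b : ℕ) :
    univ.val.map (gadgetDegree (P := P) (Q := Q) (Sum.elim d (fun _ : Y => 0)) h A b) =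
      univ.val.map (fun x => d x + h) + Multiset.replicate (Fintype.card Y) h +
        Multiset.replicate (Fintype.card P) A + Multiset.replicate (Fintype.card Q) b := by
  simp only [← Finset.univ_disjSum_univ, Finset.val_disjSum, Multiset.disjSum, Multiset.map_add,
    Multiset.map_map, Function.comp_def, gadgetDegree, Sum.elim_inl, Sum.elim_inr, zero_add,
    Multiset.map_const', Finset.card_val, Finset.card_univ, add_assoc]

/-- The map `amplify` preserves and reflects realizability. The bound on `K` makes `k = K m²`, which
divides `h`, `opk` and `o²k`, larger than `2m² + m`. -/
theorem hasBipartiteRealization_amplify_iff {o p K : ℕ} (ho : 0 < o) (hK : 4 ≤ K) (D : List ℕ) :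
    HasBipartiteRealization (amplify o p K D) ↔ HasBipartiteRealization D := by
  rcases Nat.eq_zero_or_pos (D.length + D.sum) with h0 | hm
  · have : D = [] := List.length_eq_zero_iff.1 (by omega)
    subst this
    simp [amplify]
  have : NeZero (o + p) := ⟨by omega⟩
  set m := D.length + D.sum with hm_def
  set k := K * m ^ 2 with hk_def
  set h := o * (o + p) * k with hh_def
  have hk : 2 * m * m + m < k := by nlinarith
  let X := Fin D.length
  let Y := Fin (D.length + 2 * D.sum)
  let H := Fin o × Fin k × ZMod (o + p)
  let W := Fin p × Fin k × ZMod (o + p)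
  have hH : Fintype.card H = h := by simp [H, ZMod.card, hh_def]; ring
  have hW : Fintype.card W = p * (o + p) * k := by simp [W, ZMod.card]; ring
  have hXY : Fintype.card (X ⊕ Y) = 2 * m := by simp [X, Y]; omega
  let d : X ⊕ Y → ℕ := Sum.elim D.get fun _ => 0
  have hsum : ∑ x, d x ≤ m := by
    simp only [d, Fintype.sum_sum_type, Sum.elim_inl, Sum.elim_inr, sum_const_zero, X]
    have : ∑ x : Fin D.length, D.get x = D.sum := by simp
    omega
  have hmap : univ.val.map (gadgetDegree (P := Bool × H) (Q := Bool × W) d h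
      (h + m + o * p * k) (o * o * k)) = (amplify o p K D : Multiset ℕ) := by
    rw [map_univ_gadgetDegree]
    simp only [Fintype.card_prod, Fintype.card_bool, hH, hW]
    simp only [X, Y, Fin.univ_val_map, Fintype.card_fin, amplify, ← Multiset.coe_add,
      Multiset.coe_replicate]
    congr 4
    have hget := congrArg (List.map (· + h)) (List.ofFn_get D)
    rw [List.map_ofFn] at hget
    exact hget
  have h0 : ∀ w ∉ Set.range (Function.Embedding.inl : X ↪ X ⊕ Y), d w = 0 := by
    rintro (x | y) hx
    · exact absurd ⟨x, rfl⟩ hx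
    · rfl
  rw [hasBipartiteRealization_iff_of_map_eq hmap, hasBipartiteRealization_iff_realizes]
  constructor
  · rintro ⟨c, R, hR⟩
    have := hR.of_gadget (N := k) (h := h) (v := p * (o + p) * k) hm
      (by rw [Fintype.card_prod, hH, Fintype.card_bool])
      (by rw [Fintype.card_prod, hW, Fintype.card_bool]) hXY (by rw [hh_def]; ring)
      (Dvd.intro_left _ rfl) (Dvd.intro_left _ rfl) (Dvd.intro_left _ rfl)
      hk hsum
    exact ⟨_, _, this.of_embedding Function.Embedding.inl h0⟩
  · rintro ⟨c, R, hR⟩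
    obtain ⟨c', R', hR', hc'⟩ := Realizes.exists_balanced (m := m) Function.Embedding.inl
      (d := d) hR h0 (by simp [X]; omega) hXY
    obtain ⟨B, _, hB1, hB2⟩ := exists_biregular (o := o) (p := p) (q := o + p) (k := k) (by omega)
    exact hR'.gadget hH hc' hB1 hB2

/-- If `c₁ < o² / 2q²` and `(q² - p²) / 2q² < c₂`, where `q = o + p`, then the terms of the
amplified sequence lie between `c₁ n` and `c₂ n` once `K` is large. -/
theorem exists_amplify_between {o p : ℕ} {c₁ c₂ : ℝ} (h₁ : 2 * c₁ * (o + p) ^ 2 < o ^ 2)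
    (h₂ : (o : ℝ) * (o + p) + o * p < 2 * c₂ * (o + p) ^ 2) (hc : 0 ≤ c₂) :
    ∃ K, 4 ≤ K ∧ ∀ D, ∀ d ∈ amplify o p K D,
      c₁ * (amplify o p K D).length ≤ d ∧ d ≤ c₂ * (amplify o p K D).length := by
  -- `K₁` and `K₂` make the slack in `h₁` and `h₂`, multiplied by `K m²`, exceed the terms linear
  -- in `m` that the inequalities for `c₁` and `c₂` contain
  obtain ⟨K₁, hK₁⟩ := exists_nat_gt (2 * c₁ / (o ^ 2 - 2 * c₁ * (o + p) ^ 2))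
  obtain ⟨K₂, hK₂⟩ := exists_nat_gt (1 / (2 * c₂ * (o + p) ^ 2 - (o * (o + p) + o * p)))
  refine ⟨K₁ + K₂ + 4, by omega, fun D => ?_⟩
  set K := K₁ + K₂ + 4 with hK
  rw [amplify_length]
  set m := D.length + D.sum with hm_def
  set k := K * m ^ 2 with hk_def
  rw [div_lt_iff₀ (by linarith)] at hK₁ hK₂
  have hmm : (m : ℝ) ≤ (m : ℝ) ^ 2 := by
    norm_cast
    exact Nat.le_self_pow two_ne_zero m
  have hm0 : (0 : ℝ) ≤ m := Nat.cast_nonneg m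
  have hkr : (k : ℝ) = K * (m : ℝ) ^ 2 := by simp [hk_def]
  have hKr : (K : ℝ) = K₁ + K₂ + 4 := by simp [hK]
  have hK₁0 : (0 : ℝ) ≤ K₁ := Nat.cast_nonneg _
  have hK₂0 : (0 : ℝ) ≤ K₂ := Nat.cast_nonneg _
  have hlo : c₁ * (2 * ((o + p) ^ 2 * k + m)) ≤ o * o * (k : ℝ) := by
    have h3 : 2 * c₁ ≤ (o ^ 2 - 2 * c₁ * (o + p) ^ 2) * K := by
      rw [hKr]; nlinarith
    have h4 : 2 * c₁ * m ≤ (o ^ 2 - 2 * c₁ * (o + p) ^ 2) * k := by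
      rw [hkr, ← mul_assoc]
      have h5 : 0 ≤ (o ^ 2 - 2 * c₁ * (o + p) ^ 2) * (K : ℝ) := by
        have : (0 : ℝ) ≤ K := Nat.cast_nonneg _
        have h6 : 0 ≤ (o ^ 2 - 2 * c₁ * (o + p) ^ 2) := by linarith
        positivity
      calc 2 * c₁ * m ≤ (o ^ 2 - 2 * c₁ * (o + p) ^ 2) * K * m := by gcongr
        _ ≤ _ := by gcongr
    nlinarith
  have hhi : (o : ℝ) * (o + p) * k + m + o * p * k ≤ c₂ * (2 * ((o + p) ^ 2 * k + m)) := by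
    have h3 : 1 ≤ (2 * c₂ * (o + p) ^ 2 - (o * (o + p) + o * p)) * K := by
      rw [hKr]; nlinarith
    have h4 : (m : ℝ) ≤ (2 * c₂ * (o + p) ^ 2 - (o * (o + p) + o * p)) * k := by
      rw [hkr, ← mul_assoc]
      calc (m : ℝ) ≤ 1 * (m : ℝ) ^ 2 := by linarith
        _ ≤ _ := by gcongr
    nlinarith [mul_nonneg hc hm0]
  -- every term lies between the lowest value `o * o * k` and the highest one
  have key : ∀ d ∈ amplify o p K D,
      o * o * k ≤ d ∧ d ≤ o * (o + p) * k + m + o * p * k := by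
    intro d hd
    have hle : o * o * k ≤ o * (o + p) * k := by gcongr; omega
    simp only [amplify, List.mem_append, List.mem_map, List.mem_replicate] at hd
    rw [← hm_def, ← hk_def] at hd
    rcases hd with ((⟨a, ha, rfl⟩ | ⟨-, rfl⟩) | ⟨-, rfl⟩) | ⟨-, rfl⟩
    · have := List.le_sum_of_mem ha
      constructor <;> omega
    · constructor <;> omega
    · constructor <;> omega
    · constructor <;> omega
  intro d hd
  obtain ⟨h3, h4⟩ := key d hd
  have h3' : ((o * o * k : ℕ) : ℝ) ≤ d := Nat.cast_le.2 h3
  have h4' : (d : ℝ) ≤ ((o * (o + p) * k + m + o * p * k : ℕ) : ℝ) := Nat.cast_le.2 h4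
  push_cast at h3' h4' ⊢
  rw [hkr] at *
  constructor <;> linarith

/-- With `s = √(1 - 2c₂)` the bound on `c₁` is `(1 - s)² / 2`, and `c₂ = (1 - s²) / 2`. A rational
number `p / q` slightly larger than `s` provides the constants. -/
theorem exists_constants {c₁ c₂ : ℝ} (hc₂_pos : 0 < c₂) (hc₂_lt : c₂ < 1 / 2)
    (hc₁ : c₁ < 1 - c₂ - √(1 - 2 * c₂)) :
    ∃ o p : ℕ, 0 < o ∧ 2 * c₁ * (o + p) ^ 2 < o ^ 2 ∧
      (o : ℝ) * (o + p) + o * p < 2 * c₂ * (o + p) ^ 2 := by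
  set s := √(1 - 2 * c₂) with hs
  have hs2 : s ^ 2 = 1 - 2 * c₂ := Real.sq_sqrt (by linarith)
  have hs0 : 0 < s := Real.sqrt_pos.2 (by linarith)
  have hs1 : s < 1 := by nlinarith
  obtain ⟨t, hst, ht1, ht⟩ : ∃ t, s < t ∧ t < 1 ∧ 2 * c₁ < (1 - t) ^ 2 := by
    have hcont : Continuous fun t : ℝ => (1 - t) ^ 2 := by fun_prop
    have hlt : 2 * c₁ < (1 - s) ^ 2 := by nlinarith
    have hev := (hcont.tendsto s).eventually (lt_mem_nhds hlt)
    have hev2 : ∀ᶠ t in nhdsWithin s (Set.Ioi s), s < t ∧ t < 1 ∧ 2 * c₁ < (1 - t) ^ 2 := by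
      filter_upwards [self_mem_nhdsWithin, nhdsWithin_le_nhds hev,
        nhdsWithin_le_nhds (gt_mem_nhds hs1)] with t h1 h2 h3
      exact ⟨h1, h3, h2⟩
    exact hev2.exists
  obtain ⟨r, hsr, hrt⟩ := exists_rat_btwn hst
  have hr0 : 0 < r := by exact_mod_cast hs0.trans hsr
  have hr1 : r < 1 := by exact_mod_cast hrt.trans ht1
  have hq : (0 : ℝ) < r.den := by exact_mod_cast r.den_pos
  have hnum : ((r.num.toNat : ℕ) : ℝ) = r * r.den := by
    have h1 : ((r.num.toNat : ℕ) : ℤ) = r.num := Int.toNat_of_nonneg (Rat.num_nonneg.2 hr0.le)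
    have h2 : (r : ℝ) * r.den = r.num := by exact_mod_cast Rat.mul_den_eq_num r
    rw [h2]
    exact_mod_cast h1
  have hlt : r.num.toNat < r.den := by
    have : ((r.num.toNat : ℕ) : ℝ) < r.den := by
      rw [hnum]
      have : (r : ℝ) < 1 := by exact_mod_cast hr1
      nlinarith
    exact_mod_cast this
  have hsub : ((r.den - r.num.toNat : ℕ) : ℝ) = (1 - r) * r.den := by
    rw [Nat.cast_sub hlt.le, hnum]; ring
  -- with `r = p / q` in lowest terms, `o = q - p`
  refine ⟨r.den - r.num.toNat, r.num.toNat, by omega, ?_, ?_⟩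
  · rw [hsub, hnum]
    have h1 : 2 * c₁ < (1 - (r : ℝ)) ^ 2 := by nlinarith
    have h2 : 0 < (r.den : ℝ) ^ 2 := by positivity
    nlinarith
  · rw [hsub, hnum]
    have h1 : 1 - (r : ℝ) ^ 2 < 2 * c₂ := by nlinarith
    have h2 : 0 < (r.den : ℝ) ^ 2 := by positivity
    nlinarith

end DegreeRealization

namespace DegreeRealization

open Function Turing

/-! ### Structured stack programs -/

/-- A structured program over stacks `k : K` with alphabets `Γ k`. The loop `forPop k g p₀ p₁` pops
symbols `a` from the stack `k` until it is empty, running `p₁` if `g a` holds and `p₀` if not. -/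
inductive Prog (K : Type) (Γ : K → Type) : Type
  | skip : Prog K Γ
  | push (k : K) (a : Γ k) : Prog K Γ
  | seq (p q : Prog K Γ) : Prog K Γ
  | forPop (k : K) (g : Γ k → Bool) (p₀ p₁ : Prog K Γ) : Prog K Γ

namespace Prog

variable {K : Type} {Γ : K → Type}

/-- The control points of a program. -/
def Label : Prog K Γ → Type
  | skip => Unit
  | push _ _ => Unit
  | seq p q => p.Label ⊕ q.Label
  | forPop _ _ p₀ p₁ => Unit ⊕ p₀.Label ⊕ p₁.Label

/-- The control point at which a program starts. -/
def entry : (p : Prog K Γ) → p.Label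
  | skip => ()
  | push _ _ => ()
  | seq p _ => .inl p.entry
  | forPop _ _ _ _ => .inl ()

theorem label_finite (p : Prog K Γ) : Finite p.Label := by
  induction p with
  | skip => exact inferInstanceAs (Finite Unit)
  | push => exact inferInstanceAs (Finite Unit)
  | seq p q hp hq => exact inferInstanceAs (Finite (p.Label ⊕ q.Label))
  | forPop k g p₀ p₁ h₀ h₁ => exact inferInstanceAs (Finite (Unit ⊕ p₀.Label ⊕ p₁.Label))

/-- The statements that implement a program, when its control points are placed in `Λ` by `emb` and
control passes to `exit` at its end. The second component of the internal state holds the result of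
the last `pop`. -/
def code {Λ τ : Type} : (p : Prog K Γ) → (p.Label → Λ) → Λ → p.Label →
    TM2.Stmt Γ Λ (τ × Option Bool)
  | skip, _, exit, _ => .goto fun _ => exit
  | push k a, _, exit, _ => .push k (fun _ => a) (.goto fun _ => exit)
  | seq p q, emb, exit, l => match l with
    | .inl l => p.code (fun l => emb (.inl l)) (emb (.inr q.entry)) l
    | .inr l => q.code (fun l => emb (.inr l)) exit l
  | forPop k g p₀ p₁, emb, exit, l => match l with
    | .inl _ => .pop k (fun v a => (v.1, a.map g)) (.goto fun v => match v.2 with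
      | none => exit
      | some false => emb (.inr (.inl p₀.entry))
      | some true => emb (.inr (.inr p₁.entry)))
    | .inr (.inl l) => p₀.code (fun l => emb (.inr (.inl l))) (emb (.inl ())) l
    | .inr (.inr l) => p₁.code (fun l => emb (.inr (.inr l))) (emb (.inl ())) l

variable [DecidableEq K]

/-- `Run p S t S'`: started with stacks `S`, the program `p` stops after `t` steps with
stacks `S'`. -/
inductive Run : Prog K Γ → (∀ k, List (Γ k)) → ℕ → (∀ k, List (Γ k)) → Prop
  | skip (S) : Run skip S 1 S
  | push (k a S) : Run (push k a) S 1 (update S k (a :: S k))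
  | seq {p q S S' S'' t t'} : Run p S t S' → Run q S' t' S'' → Run (seq p q) S (t + t') S''
  | forPop_nil {k g p₀ p₁ S} : S k = [] → Run (forPop k g p₀ p₁) S 1 S
  | forPop_cons {k g p₀ p₁ S S' S'' t t' a l} : S k = a :: l →
      Run (bif g a then p₁ else p₀) (update S k l) t S' → Run (forPop k g p₀ p₁) S' t' S'' →
      Run (forPop k g p₀ p₁) S (1 + t + t') S''

/-- The step function of a machine, on configurations that may have halted. -/
def next {Λ σ : Type} (M : Λ → TM2.Stmt Γ Λ σ) : Option (TM2.Cfg Γ Λ σ) → Option (TM2.Cfg Γ Λ σ) :=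
  flip bind (TM2.step M)

/-- A machine that contains the code of a program executes it. -/
theorem Run.next_iterate {Λ τ : Type} {M : Λ → TM2.Stmt Γ Λ (τ × Option Bool)} {p : Prog K Γ}
    {S S' : ∀ k, List (Γ k)} {t : ℕ} (h : Run p S t S') {emb : p.Label → Λ} {exit : Λ}
    (hM : ∀ l, M (emb l) = p.code emb exit l) (v : τ × Option Bool) :
    ∃ v', (next M)^[t] (some ⟨some (emb p.entry), v, S⟩) = some ⟨some exit, v', S'⟩ := by
  induction h generalizing exit v with
  | skip S =>
    refine ⟨v, ?_⟩
    simp [next, flip, hM, code]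
  | push k a S =>
    refine ⟨v, ?_⟩
    simp [next, flip, hM, code]
  | @seq p q S S' S'' t t' _ _ ih₁ ih₂ =>
    obtain ⟨v₁, h₁⟩ := ih₁ (emb := fun l => emb (.inl l)) (exit := emb (.inr q.entry))
      (fun l => hM (.inl l)) v
    obtain ⟨v₂, h₂⟩ := ih₂ (emb := fun l => emb (.inr l)) (exit := exit) (fun l => hM (.inr l)) v₁
    refine ⟨v₂, ?_⟩
    rw [add_comm, iterate_add_apply]
    exact (congrArg _ h₁).trans h₂
  | @forPop_nil k g p₀ p₁ S hS =>
    refine ⟨(v.1, none), ?_⟩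
    have hup : update S k [] = S := by rw [← hS, update_eq_self]
    have := hM (.inl ())
    simp [next, flip, entry, this, code, hS, hup]
  | @forPop_cons k g p₀ p₁ S S' S'' t t' a l hS _ _ ih₁ ih₂ =>
    have h₀ : ∃ v₀, (next M) (some ⟨some (emb (.inl ())), v, S⟩) =
        some ⟨some (bif g a then emb (.inr (.inr p₁.entry)) else emb (.inr (.inl p₀.entry))), v₀,
          update S k l⟩ := by
      refine ⟨(v.1, some (g a)), ?_⟩
      have := hM (.inl ())
      cases hg : g a <;> simp [next, flip, this, code, hS, hg]
    obtain ⟨v₀, h₀⟩ := h₀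
    have h₁ : ∃ v₁, (next M)^[t] (some ⟨some (bif g a then emb (.inr (.inr p₁.entry)) else
        emb (.inr (.inl p₀.entry))), v₀, update S k l⟩) = some ⟨some (emb (.inl ())), v₁, S'⟩ := by
      cases hg : g a
      · rw [hg] at ih₁
        exact ih₁ (emb := fun l => emb (.inr (.inl l))) (fun l => hM (.inr (.inl l))) v₀
      · rw [hg] at ih₁
        exact ih₁ (emb := fun l => emb (.inr (.inr l))) (fun l => hM (.inr (.inr l))) v₀
    obtain ⟨v₁, h₁⟩ := h₁
    obtain ⟨v₂, h₂⟩ := ih₂ hM v₁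
    refine ⟨v₂, ?_⟩
    rw [add_comm, iterate_add_apply, add_comm 1 t, iterate_add_apply, iterate_one]
    exact (congrArg _ ((congrArg _ h₀).trans h₁)).trans h₂

end Prog

end DegreeRealization

namespace DegreeRealization

open Function Turing StateTransition

/-! ### Running a program on the output of a machine -/

/-- Additional stacks: an output stack `none`, and four registers, each of which is a pair of a main
stack `some (i, false)` and an auxiliary stack `some (i, true)`. -/
abbrev Aux : Type := Option (Fin 4 × Bool)

/-- The alphabets of a machine with the additional stacks. -/
abbrev Alphabet {K : Type} (Γ : K → Type) : K ⊕ Aux → Type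
  | .inl k => Γ k
  | .inr _ => Bool

/-- The stacks of a machine together with the output stack, the main stacks and the auxiliary
stacks of the registers. -/
def allStacks {K : Type} {Γ : K → Type} (S : ∀ k, List (Γ k)) (o : List Bool)
    (f g : Fin 4 → List Bool) : ∀ k, List (Alphabet Γ k)
  | .inl k => S k
  | .inr none => o
  | .inr (some (i, false)) => f i
  | .inr (some (i, true)) => g i

section allStacks

variable {K : Type} [DecidableEq K] {Γ : K → Type} (S : ∀ k, List (Γ k)) (o : List Bool)
  (f g : Fin 4 → List Bool)

theorem update_allStacks_inl (k : K) (l : List (Γ k)) :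
    update (allStacks S o f g) (.inl k) l = allStacks (update S k l) o f g := by
  funext j
  rcases j with j | _ | ⟨j, _ | _⟩
  · by_cases h : j = k
    · subst h; simp [allStacks]
    · rw [update_of_ne (by simpa using h)]; simp [allStacks, h]
  all_goals rw [update_of_ne (by simp)]; rfl

theorem update_allStacks_out (l : List Bool) :
    update (allStacks S o f g) (.inr none) l = allStacks S l f g := by
  funext j
  rcases j with j | _ | ⟨j, _ | _⟩
  · rw [update_of_ne (by simp)]; rfl
  · rw [update_self]; rfl
  all_goals rw [update_of_ne (by simp)]; rfl

theorem update_allStacks_main (i : Fin 4) (l : List Bool) :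
    update (allStacks S o f g) (.inr (some (i, false))) l = allStacks S o (update f i l) g := by
  funext j
  rcases j with j | _ | ⟨j, _ | _⟩
  · rw [update_of_ne (by simp)]; rfl
  · rw [update_of_ne (by simp)]; rfl
  · by_cases h : j = i
    · subst h; simp [allStacks]
    · rw [update_of_ne (by simpa using h)]; simp [allStacks, h]
  · rw [update_of_ne (by simp)]; rfl

theorem update_allStacks_aux (i : Fin 4) (l : List Bool) :
    update (allStacks S o f g) (.inr (some (i, true))) l = allStacks S o f (update g i l) := by
  funext j
  rcases j with j | _ | ⟨j, _ | _⟩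
  · rw [update_of_ne (by simp)]; rfl
  · rw [update_of_ne (by simp)]; rfl
  · rw [update_of_ne (by simp)]; rfl
  · by_cases h : j = i
    · subst h; simp [allStacks]
    · rw [update_of_ne (by simpa using h)]; simp [allStacks, h]

end allStacks

section append

/-- The statements of a machine, as statements of a machine with additional stacks; halting is
replaced by a jump to `exit`. -/
def liftStmt {K Λ Λ' σ : Type} {Γ : K → Type} (emb : Λ → Λ') (exit : Λ') :
    TM2.Stmt Γ Λ σ → TM2.Stmt (Alphabet Γ) Λ' (σ × Option Bool)
  | .push k a q => .push (.inl k) (fun v => a v.1) (liftStmt emb exit q)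
  | .peek k a q => .peek (.inl k) (fun v x => (a v.1 x, v.2)) (liftStmt emb exit q)
  | .pop k a q => .pop (.inl k) (fun v x => (a v.1 x, v.2)) (liftStmt emb exit q)
  | .load a q => .load (fun v => (a v.1, v.2)) (liftStmt emb exit q)
  | .branch a q₁ q₂ => .branch (fun v => a v.1) (liftStmt emb exit q₁) (liftStmt emb exit q₂)
  | .goto a => .goto fun v => emb (a v.1)
  | .halt => .goto fun _ => exit

/-- The configurations of a machine, as configurations of a machine with additional stacks. -/
def liftCfg {K Λ Λ' σ : Type} {Γ : K → Type} (emb : Λ → Λ') (exit : Λ') (c : TM2.Cfg Γ Λ σ) :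
    TM2.Cfg (Alphabet Γ) Λ' (σ × Option Bool) where
  l := some (c.l.elim exit emb)
  var := (c.var, none)
  stk := allStacks c.stk [] (fun _ => []) (fun _ => [])

variable {K Λ Λ' σ : Type} [DecidableEq K] {Γ : K → Type} {emb : Λ → Λ'} {exit : Λ'}

theorem next_iterate_none (M : Λ → TM2.Stmt Γ Λ σ) (n : ℕ) : (Prog.next M)^[n] none = none := by
  induction n with
  | zero => rfl
  | succ n ih => rwa [iterate_succ_apply]

/-- The additional stacks stay empty while the original machine runs. -/
theorem stepAux_liftStmt (q : TM2.Stmt Γ Λ σ) (v : σ) (S : ∀ k, List (Γ k)) :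
    TM2.stepAux (liftStmt emb exit q) (v, none) (allStacks S [] (fun _ => []) fun _ => []) =
      liftCfg emb exit (TM2.stepAux q v S) := by
  induction q generalizing v S with
  | push k a q ih =>
    simp only [liftStmt, TM2.stepAux]
    rw [update_allStacks_inl, ← ih]
    rfl
  | peek k a q ih =>
    simp only [liftStmt, TM2.stepAux]
    rw [← ih]
    rfl
  | pop k a q ih =>
    simp only [liftStmt, TM2.stepAux]
    rw [update_allStacks_inl, ← ih]
    rfl
  | load a q ih => simp only [liftStmt, TM2.stepAux, ih]
  | branch a q₁ q₂ ih₁ ih₂ =>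
    simp only [liftStmt, TM2.stepAux]
    cases a v
    · exact ih₂ v S
    · exact ih₁ v S
  | goto a => rfl
  | halt => rfl

theorem next_iterate_liftCfg {M : Λ → TM2.Stmt Γ Λ σ}
    {M' : Λ' → TM2.Stmt (Alphabet Γ) Λ' (σ × Option Bool)}
    (hM : ∀ l, M' (emb l) = liftStmt emb exit (M l)) {c c' : TM2.Cfg Γ Λ σ} {n : ℕ}
    (h : (Prog.next M)^[n] (some c) = some c') :
    (Prog.next M')^[n] (some (liftCfg emb exit c)) = some (liftCfg emb exit c') := by
  induction n generalizing c with
  | zero =>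
    cases h
    rfl
  | succ n ih =>
    rw [iterate_succ_apply] at h ⊢
    obtain ⟨l, v, S⟩ := c
    cases l with
    | none =>
      have : (Prog.next M)^[n] none = some c' := h
      rw [next_iterate_none] at this
      cases this
    | some l =>
      rw [← ih (c := TM2.stepAux (M l) v S) h]
      congr 1
      change some (TM2.stepAux (M' (emb l)) _ _) = _
      rw [hM]
      exact congrArg some (stepAux_liftStmt _ _ _)

/-- The number of `push` instructions in a statement, those of both branches included. -/
def pushes : TM2.Stmt Γ Λ σ → ℕ
  | .push _ _ q => pushes q + 1
  | .peek _ _ q => pushes q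
  | .pop _ _ q => pushes q
  | .load _ q => pushes q
  | .branch _ q₁ q₂ => pushes q₁ + pushes q₂
  | .goto _ => 0
  | .halt => 0

theorem length_stepAux_le (q : TM2.Stmt Γ Λ σ) (v : σ) (S : ∀ k, List (Γ k)) (k : K) {n : ℕ}
    (hn : ∀ k, (S k).length ≤ n) : ((TM2.stepAux q v S).stk k).length ≤ n + pushes q := by
  induction q generalizing v S n with
  | push j a q ih =>
    have := ih v (update S j (a v :: S j)) (n := n + 1) (fun i => by
      by_cases h : i = j
      · subst h; simpa using hn i
      · rw [update_of_ne h]; exact (hn i).trans n.le_succ)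
    simp only [TM2.stepAux, pushes]
    omega
  | peek j a q ih => exact ih _ _ hn
  | pop j a q ih =>
    refine ih _ _ fun i => ?_
    by_cases h : i = j
    · subst h
      have := hn i
      simp only [update_self, List.length_tail]
      omega
    · rw [update_of_ne h]; exact hn i
  | load a q ih => exact ih _ _ hn
  | branch a q₁ q₂ ih₁ ih₂ =>
    simp only [TM2.stepAux, pushes]
    have h₁ := ih₁ v S hn
    have h₂ := ih₂ v S hn
    cases a v
    · exact h₂.trans (by omega)
    · exact h₁.trans (by omega)
  | goto a => exact hn k
  | halt => exact hn k

/-- A machine whose statements contain at most `C` pushes adds at most `C` symbols to a stack in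
each step. -/
theorem length_next_iterate_le {M : Λ → TM2.Stmt Γ Λ σ} {C : ℕ} (hC : ∀ l, pushes (M l) ≤ C)
    {c c' : TM2.Cfg Γ Λ σ} {t n : ℕ} (hn : ∀ k, (c.stk k).length ≤ n)
    (h : (Prog.next M)^[t] (some c) = some c') (k : K) : (c'.stk k).length ≤ n + C * t := by
  induction t generalizing c n with
  | zero =>
    cases h
    simpa using hn k
  | succ t ih =>
    rw [iterate_succ_apply] at h
    obtain ⟨l, v, S⟩ := c
    cases l with
    | none =>
      have : (Prog.next M)^[t] none = some c' := h
      rw [next_iterate_none] at this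
      cases this
    | some l =>
      have := ih (c := TM2.stepAux (M l) v S) (n := n + C)
        (fun k => (length_stepAux_le _ _ _ k hn).trans (Nat.add_le_add_left (hC l) n)) h
      rw [Nat.mul_succ]
      omega

end append

/-- The machine that runs `tm`, then the program `p`, and then resets its internal state. Its output
is the output stack of `p`. -/
noncomputable def appendProg (tm : FinTM2) (p : Prog (tm.K ⊕ Aux) (Alphabet tm.Γ)) : FinTM2 :=
  letI := tm.kFin
  letI := tm.ΛFin
  letI := tm.σFin
  letI := tm.Γk₀Fin
  letI := p.label_finite
  letI : Fintype p.Label := Fintype.ofFinite _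
  { K := tm.K ⊕ Aux
    k₀ := .inl tm.k₀
    k₁ := .inr none
    Γ := Alphabet tm.Γ
    Λ := Option (tm.Λ ⊕ p.Label)
    main := some (.inl tm.main)
    σ := tm.σ × Option Bool
    initialState := (tm.initialState, none)
    Γk₀Fin := inferInstanceAs (Fintype (tm.Γ tm.k₀))
    m := fun l => match l with
      | some (.inl l) =>
        liftStmt (fun l => some (.inl l)) (some (.inr p.entry)) (tm.m l)
      | some (.inr l) => p.code (fun l => some (.inr l)) none l
      | none => .load (fun _ => (tm.initialState, none)) .halt }

theorem initList_stk (tm : FinTM2) (s : List (tm.Γ tm.k₀)) :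
    (initList tm s).stk = update (fun _ => []) tm.k₀ s := by
  funext k
  by_cases h : k = tm.k₀
  · subst h; simp [initList]
  · simp [initList, h]

theorem haltList_stk (tm : FinTM2) (s : List (tm.Γ tm.k₁)) :
    (haltList tm s).stk = update (fun _ => []) tm.k₁ s := by
  funext k
  by_cases h : k = tm.k₁
  · subst h; simp [haltList]
  · simp [haltList, h]

theorem allStacks_nil {K : Type} {Γ : K → Type} :
    allStacks (Γ := Γ) (fun _ => []) [] (fun _ => []) (fun _ => []) = fun _ => [] := by
  funext k
  rcases k with k | _ | ⟨k, _ | _⟩ <;> rfl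

theorem initList_appendProg (tm : FinTM2) (p : Prog (tm.K ⊕ Aux) (Alphabet tm.Γ))
    (s : List (tm.Γ tm.k₀)) : initList (appendProg tm p) s =
      liftCfg (Λ' := (appendProg tm p).Λ) (fun l => some (.inl l)) (some (.inr p.entry))
        (initList tm s) := by
  have h : (initList (appendProg tm p) s).stk =
      allStacks (initList tm s).stk [] (fun _ => []) fun _ => [] := by
    refine (initList_stk _ _).trans ?_
    rw [initList_stk tm s, ← update_allStacks_inl, allStacks_nil]
    rfl
  exact congrArg (TM2.Cfg.mk _ _) h

theorem haltList_appendProg (tm : FinTM2) (p : Prog (tm.K ⊕ Aux) (Alphabet tm.Γ))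
    (w : List Bool) : haltList (appendProg tm p) w =
      ⟨none, (tm.initialState, none), allStacks (fun _ => []) w (fun _ => []) fun _ => []⟩ := by
  have h : (haltList (appendProg tm p) w).stk =
      allStacks (fun _ => []) w (fun _ => []) fun _ => [] := by
    refine (haltList_stk _ _).trans ?_
    rw [← update_allStacks_out _ [], allStacks_nil]
    rfl
  exact congrArg (TM2.Cfg.mk _ _) h

/-- The running times add up; the last step resets the internal state, as the halting configuration
requires. -/
theorem appendProg_outputs {tm : FinTM2} {p : Prog (tm.K ⊕ Aux) (Alphabet tm.Γ)}
    {s : List (tm.Γ tm.k₀)} {s' : List (tm.Γ tm.k₁)} {n t : ℕ} {w : List Bool}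
    (h : (Prog.next tm.m)^[n] (some (initList tm s)) = some (haltList tm s'))
    (hp : Prog.Run p (allStacks (haltList tm s').stk [] (fun _ => []) fun _ => []) t
      (allStacks (fun _ => []) w (fun _ => []) fun _ => [])) :
    (Prog.next (appendProg tm p).m)^[n + t + 1] (some (initList (appendProg tm p) s)) =
      some (haltList (appendProg tm p) w) := by
  have h₁ := next_iterate_liftCfg (M' := (appendProg tm p).m) (emb := fun l => some (.inl l))
    (exit := some (.inr p.entry)) (fun l => rfl) h
  obtain ⟨v, h₂⟩ := hp.next_iterate (M := (appendProg tm p).m) (emb := fun l => some (.inr l))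
    (exit := none) (fun l => rfl) ((haltList tm s').var, none)
  rw [initList_appendProg, haltList_appendProg, add_comm n t, iterate_succ_apply',
    iterate_add_apply]
  exact congrArg _ ((congrArg _ h₁).trans h₂)

end DegreeRealization

namespace DegreeRealization

open Function Turing StateTransition

/-! ### Programs made of nested loops over a word -/

section emits

variable {K : Type} [DecidableEq K] {Γ : K → Type}

/-- The program that writes `b` on the output stack. -/
def emit (b : Bool) : Prog (K ⊕ Aux) (Alphabet Γ) := .push (.inr none) b

/-- The program that moves the contents of the auxiliary stack of a register to its main stack. -/
def rewind (i : Fin 4) : Prog (K ⊕ Aux) (Alphabet Γ) :=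
  .forPop (.inr (some (i, true))) id (.push (.inr (some (i, false))) false)
    (.push (.inr (some (i, false))) true)

/-- The first half of a loop over a register: its symbols are moved one by one to the auxiliary
stack, and the body is run for each of them. -/
def sweep (i : Fin 4) (p₀ p₁ : Prog (K ⊕ Aux) (Alphabet Γ)) : Prog (K ⊕ Aux) (Alphabet Γ) :=
  .forPop (.inr (some (i, false))) id (.seq (.push (.inr (some (i, true))) false) p₀)
    (.seq (.push (.inr (some (i, true))) true) p₁)

/-- A loop over the contents of a register, which are restored at the end. -/
def loop (i : Fin 4) (p₀ p₁ : Prog (K ⊕ Aux) (Alphabet Γ)) : Prog (K ⊕ Aux) (Alphabet Γ) :=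
  .seq (sweep i p₀ p₁) (rewind i)

/-- The program that repeats another one a fixed number of times. -/
def repeatProg (p : Prog (K ⊕ Aux) (Alphabet Γ)) : ℕ → Prog (K ⊕ Aux) (Alphabet Γ)
  | 0 => .skip
  | n + 1 => .seq p (repeatProg p n)

/-- If the registers in `X` hold the word `w`, its last letter on top, then the program `p` writes
`u w` in front of the output in polynomial time, and leaves all the other stacks as they were. -/
def Emits (X : Set (Fin 4)) (p : Prog (K ⊕ Aux) (Alphabet Γ)) (u : List Bool → List Bool) : Prop :=
  ∃ T : Polynomial ℕ, ∀ (w : List Bool) (S : ∀ k, List (Γ k)) (o : List Bool)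
    (f g : Fin 4 → List Bool), (∀ i ∈ X, f i = w.reverse ∧ g i = []) →
      ∃ t ≤ T.eval w.length, Prog.Run p (allStacks S o f g) t (allStacks S (u w ++ o) f g)

variable {X : Set (Fin 4)} {p p₀ p₁ q : Prog (K ⊕ Aux) (Alphabet Γ)}
  {u u₀ u₁ v : List Bool → List Bool}

theorem emits_skip : Emits (Γ := Γ) X .skip fun _ => [] :=
  ⟨1, fun w S o f g _ => ⟨1, by simp, .skip _⟩⟩

theorem emits_emit (b : Bool) : Emits (Γ := Γ) X (emit b) fun _ => [b] := by
  refine ⟨1, fun w S o f g _ => ⟨1, by simp, ?_⟩⟩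
  have := Prog.Run.push (.inr none) b (allStacks S o f g)
  rwa [update_allStacks_out] at this

/-- Since output is written in front, the program that runs last contributes the first part. -/
theorem Emits.seq (hp : Emits X p u) (hq : Emits X q v) :
    Emits X (.seq p q) fun w => v w ++ u w := by
  obtain ⟨T, hT⟩ := hp
  obtain ⟨T', hT'⟩ := hq
  refine ⟨T + T', fun w S o f g h => ?_⟩
  obtain ⟨t, ht, hr⟩ := hT w S o f g h
  obtain ⟨t', ht', hr'⟩ := hT' w S (u w ++ o) f g h
  rw [← List.append_assoc] at hr'
  exact ⟨t + t', by rw [Polynomial.eval_add]; omega, hr.seq hr'⟩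

theorem Emits.repeatProg (hp : Emits X p u) (n : ℕ) :
    Emits X (repeatProg p n) fun w => (List.replicate n (u w)).flatten := by
  induction n with
  | zero => exact emits_skip
  | succ n ih =>
    have := hp.seq ih
    refine cast (congrArg _ (funext fun w => ?_)) this
    rw [List.replicate_succ', List.flatten_append]
    simp

theorem run_push_main (i : Fin 4) (b : Bool) (S : ∀ k, List (Γ k)) (o : List Bool)
    (f g : Fin 4 → List Bool) : Prog.Run (.push (.inr (some (i, false))) b) (allStacks S o f g) 1
      (allStacks S o (update f i (b :: f i)) g) := by
  have := Prog.Run.push (.inr (some (i, false))) b (allStacks S o f g)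
  rwa [update_allStacks_main] at this

theorem run_push_aux (i : Fin 4) (b : Bool) (S : ∀ k, List (Γ k)) (o : List Bool)
    (f g : Fin 4 → List Bool) : Prog.Run (.push (.inr (some (i, true))) b) (allStacks S o f g) 1
      (allStacks S o f (update g i (b :: g i))) := by
  have := Prog.Run.push (.inr (some (i, true))) b (allStacks S o f g)
  rwa [update_allStacks_aux] at this

theorem run_rewind (i : Fin 4) (S : ∀ k, List (Γ k)) (o l : List Bool) (f g : Fin 4 → List Bool)
    (hl : g i = l) : Prog.Run (rewind i) (allStacks S o f g) (2 * l.length + 1)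
      (allStacks S o (update f i (l.reverse ++ f i)) (update g i [])) := by
  induction l generalizing f g with
  | nil =>
    have h : update g i [] = g := by rw [← hl, update_eq_self]
    simp only [List.reverse_nil, List.nil_append, update_eq_self, h]
    exact .forPop_nil hl
  | cons a l ih =>
    have h := ih (update f i (a :: f i)) (update g i l) (by simp)
    simp only [update_self, update_idem] at h
    have h₁ := run_push_main i a S o f (update g i l)
    have h₂ : Prog.Run (rewind i) (allStacks S o f g) (1 + 1 + (2 * l.length + 1))
        (allStacks S o (update f i (l.reverse ++ a :: f i)) (update g i [])) := by
      refine .forPop_cons (a := a) (l := l) hl ?_ h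
      rw [update_allStacks_aux]
      cases a <;> exact h₁
    convert h₂ using 1
    · simp; ring
    · simp

/-- The body of the loop is only assumed to be correct when the registers in `X` hold `w`; as `i` is
not in `X`, it may run while the register `i` is being moved. -/
theorem exists_run_sweep {i : Fin 4} (hi : i ∉ X) {T : ℕ} {w : List Bool}
    {c : Bool → List Bool} (hp : ∀ (a : Bool) (S : ∀ k, List (Γ k)) (o : List Bool)
      (f g : Fin 4 → List Bool), (∀ i ∈ X, f i = w.reverse ∧ g i = []) →
      ∃ t ≤ T, Prog.Run (bif a then p₁ else p₀) (allStacks S o f g) t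
        (allStacks S (c a ++ o) f g))
    (S : ∀ k, List (Γ k)) (o l : List Bool) (f g : Fin 4 → List Bool) (hl : f i = l)
    (h : ∀ i ∈ X, f i = w.reverse ∧ g i = []) :
    ∃ t ≤ l.length * (T + 2) + 1, Prog.Run (sweep i p₀ p₁) (allStacks S o f g) t
      (allStacks S (l.reverse.flatMap c ++ o) (update f i []) (update g i (l.reverse ++ g i))) := by
  induction l generalizing o f g with
  | nil =>
    have h' : update f i [] = f := by rw [← hl, update_eq_self]
    simp only [List.reverse_nil, List.nil_append, update_eq_self, h', List.flatMap_nil]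
    exact ⟨1, by simp, .forPop_nil hl⟩
  | cons a l ih =>
    have hX : ∀ j ∈ X, update f i l j = w.reverse ∧ update g i (a :: g i) j = [] := by
      intro j hj
      have hne : j ≠ i := fun e => hi (e ▸ hj)
      rw [update_of_ne hne, update_of_ne hne]
      exact h j hj
    obtain ⟨t, ht, hr⟩ := hp a S o (update f i l) (update g i (a :: g i)) hX
    obtain ⟨t', ht', hr'⟩ := ih (c a ++ o) (update f i l) (update g i (a :: g i)) (by simp) hX
    simp only [update_self, update_idem] at hr'
    have h₁ := (run_push_aux i a S o (update f i l) g).seq hr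
    have h₂ : Prog.Run (sweep i p₀ p₁) (allStacks S o f g) (1 + (1 + t) + t')
        (allStacks S (l.reverse.flatMap c ++ (c a ++ o)) (update f i [])
          (update g i (l.reverse ++ a :: g i))) := by
      refine .forPop_cons (a := a) (l := l) hl ?_ hr'
      rw [update_allStacks_main]
      cases a <;> exact h₁
    refine ⟨1 + (1 + t) + t', ?_, ?_⟩
    · rw [List.length_cons, Nat.succ_mul]; omega
    · simpa using h₂

/-- The register is popped starting from the last letter of `w`, so the words written for its
letters appear in the order of `w`. -/
theorem Emits.loop {i : Fin 4} (hi : i ∉ X) (h₀ : Emits X p₀ u₀) (h₁ : Emits X p₁ u₁) :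
    Emits (insert i X) (loop i p₀ p₁) fun w => w.flatMap fun a => bif a then u₁ w else u₀ w := by
  obtain ⟨T₀, hT₀⟩ := h₀
  obtain ⟨T₁, hT₁⟩ := h₁
  refine ⟨.X * (T₀ + T₁ + 4) + 2, fun w S o f g h => ?_⟩
  have hX : ∀ i ∈ X, f i = w.reverse ∧ g i = [] := fun i hi => h i (Set.mem_insert_of_mem _ hi)
  obtain ⟨hfi, hgi⟩ := h i (Set.mem_insert _ _)
  obtain ⟨t, ht, hr⟩ := exists_run_sweep (p₀ := p₀) (p₁ := p₁) hi
    (T := T₀.eval w.length + T₁.eval w.length) (w := w) (c := fun a => bif a then u₁ w else u₀ w)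
    (fun a S o f g h => by
      cases a
      · obtain ⟨t, ht, hr⟩ := hT₀ w S o f g h
        exact ⟨t, by omega, hr⟩
      · obtain ⟨t, ht, hr⟩ := hT₁ w S o f g h
        exact ⟨t, by omega, hr⟩) S o _ f g hfi hX
  have hr' := run_rewind i S (w.reverse.reverse.flatMap (fun a => bif a then u₁ w else u₀ w) ++ o)
    w (update f i []) (update g i (w.reverse.reverse ++ g i)) (by simp [hgi])
  have hf : update f i w.reverse = f := by rw [← hfi, update_eq_self]
  have hg : update g i [] = g := by rw [← hgi, update_eq_self]
  simp only [List.reverse_reverse, update_self, update_idem, List.append_nil, hgi, hf, hg] at hr hr'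
  refine ⟨_, ?_, hr.seq hr'⟩
  simp only [Polynomial.eval_add, Polynomial.eval_mul, Polynomial.eval_X, Polynomial.eval_ofNat,
    List.length_reverse] at ht ⊢
  nlinarith

theorem Emits.mono {Y : Set (Fin 4)} (h : Emits X p u) (hXY : X ⊆ Y) : Emits Y p u := by
  obtain ⟨T, hT⟩ := h
  exact ⟨T, fun w S o f g h => hT w S o f g fun i hi => h i (hXY hi)⟩

end emits

end DegreeRealization

namespace DegreeRealization

open Function Turing StateTransition

/-! ### Composition with a polynomial-time computable function -/

section

variable {K : Type} [DecidableEq K] {Γ : K → Type}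

/-- The program that pushes `b` on the main stack of every register. -/
def pushAll (b : Bool) : Prog (K ⊕ Aux) (Alphabet Γ) :=
  .seq (.push (.inr (some (0, false))) b) (.seq (.push (.inr (some (1, false))) b)
    (.seq (.push (.inr (some (2, false))) b) (.push (.inr (some (3, false))) b)))

/-- The program that moves the contents of the stack `k` to all the registers. -/
def distribute (k : K) (e : Γ k → Bool) : Prog (K ⊕ Aux) (Alphabet Γ) :=
  .forPop (.inl k) e (pushAll false) (pushAll true)

/-- The program that empties a register. -/
def clear (i : Fin 4) : Prog (K ⊕ Aux) (Alphabet Γ) :=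
  .forPop (.inr (some (i, false))) id .skip .skip

/-- The program that empties all the registers. -/
def clearAll : Prog (K ⊕ Aux) (Alphabet Γ) :=
  .seq (clear 0) (.seq (clear 1) (.seq (clear 2) (clear 3)))

theorem run_pushAll (b : Bool) (S : ∀ k, List (Γ k)) (o : List Bool) (f g : Fin 4 → List Bool) :
    Prog.Run (pushAll b) (allStacks S o f g) 4 (allStacks S o (fun i => b :: f i) g) := by
  have h := (run_push_main 0 b S o f g).seq ((run_push_main 1 b S o _ g).seq
    ((run_push_main 2 b S o _ g).seq (run_push_main 3 b S o _ g)))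
  refine cast (congrArg (fun F => Prog.Run (pushAll b) (allStacks S o f g) 4
    (allStacks S o F g)) (funext fun i => ?_)) h
  fin_cases i <;> simp [update]

theorem run_distribute (k : K) (e : Γ k → Bool) (S : ∀ k, List (Γ k)) (o : List Bool)
    (f g : Fin 4 → List Bool) (l : List (Γ k)) (hl : S k = l) :
    Prog.Run (distribute k e) (allStacks S o f g) (5 * l.length + 1)
      (allStacks (update S k []) o (fun i => (l.map e).reverse ++ f i) g) := by
  induction l generalizing S f with
  | nil =>
    have h : update S k [] = S := by rw [← hl, update_eq_self]
    simp only [h, List.map_nil, List.reverse_nil, List.nil_append]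
    exact .forPop_nil hl
  | cons a l ih =>
    have h := ih (update S k l) (fun i => e a :: f i) (by simp)
    simp only [update_idem] at h
    have h₂ : Prog.Run (distribute k e) (allStacks S o f g) (1 + 4 + (5 * l.length + 1))
        (allStacks (update S k []) o (fun i => (l.map e).reverse ++ (e a :: f i)) g) := by
      refine .forPop_cons (a := a) (l := l) hl ?_ h
      rw [update_allStacks_inl]
      cases e a <;> exact run_pushAll _ _ _ _ _
    convert h₂ using 1
    · simp; ring
    · simp

theorem run_clear (i : Fin 4) (S : ∀ k, List (Γ k)) (o : List Bool) (f g : Fin 4 → List Bool)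
    (l : List Bool) (hl : f i = l) : Prog.Run (clear i) (allStacks S o f g) (2 * l.length + 1)
      (allStacks S o (update f i []) g) := by
  induction l generalizing f with
  | nil =>
    have h : update f i [] = f := by rw [← hl, update_eq_self]
    rw [h]
    exact .forPop_nil hl
  | cons a l ih =>
    have h := ih (update f i l) (by simp)
    rw [update_idem] at h
    have h₂ : Prog.Run (clear i) (allStacks S o f g) (1 + 1 + (2 * l.length + 1))
        (allStacks S o (update f i []) g) := by
      refine .forPop_cons (a := a) (l := l) hl ?_ h
      rw [update_allStacks_main]
      cases a <;> exact .skip _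
    convert h₂ using 1
    simp; ring

theorem run_clearAll (S : ∀ k, List (Γ k)) (o : List Bool) (f g : Fin 4 → List Bool) (n : ℕ)
    (hn : ∀ i, (f i).length = n) : Prog.Run clearAll (allStacks S o f g) (8 * n + 4)
      (allStacks S o (fun _ => []) g) := by
  have h := (run_clear 0 S o f g _ rfl).seq ((run_clear 1 S o _ g _ rfl).seq
    ((run_clear 2 S o _ g _ rfl).seq (run_clear 3 S o _ g _ rfl)))
  refine cast (congrArg₂ (fun t F => Prog.Run clearAll (allStacks S o f g) t
    (allStacks S o F g)) ?_ (funext fun i => ?_)) h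
  · simp [update, hn]; ring
  · fin_cases i <;> simp [update]

end

theorem eval_mono_nat (P : Polynomial ℕ) {a b : ℕ} (h : a ≤ b) : P.eval a ≤ P.eval b := by
  induction P using Polynomial.induction_on' with
  | add p q hp hq => simp only [Polynomial.eval_add]; omega
  | monomial n c => simp only [Polynomial.eval_monomial]; gcongr

/-- A map that a program of nested loops computes from words to words can be composed with any
polynomial-time computable function. -/
theorem PolyTimeComputable.comp_emits {α β γ Δ : Type} {ea : α → List Δ} {eb : β → List Bool}
    {ec : γ → List Bool} {f : α → β} {g : β → γ} {u : List Bool → List Bool}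
    (hf : PolyTimeComputable ea eb f) (hu : ∀ b, ec (g b) = u (eb b))
    (hp : ∀ (K : Type) [DecidableEq K] (Γ : K → Type),
      ∃ p : Prog (K ⊕ Aux) (Alphabet Γ), Emits Set.univ p u) :
    PolyTimeComputable ea ec fun a => g (f a) := by
  obtain ⟨⟨⟨tm, eIn, eOut⟩, time, hout⟩⟩ := hf
  obtain ⟨p, T, hT⟩ := hp tm.K tm.Γ
  have := tm.ΛFin
  let C : ℕ := ∑ l, pushes (tm.m l)
  have hC : ∀ l, pushes (tm.m l) ≤ C := fun l =>
    Finset.single_le_sum (f := fun l => pushes (tm.m l)) (fun _ _ => Nat.zero_le _)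
      (Finset.mem_univ l)
  let p' : Prog (tm.K ⊕ Aux) (Alphabet tm.Γ) := .seq (distribute tm.k₁ eOut) (.seq p clearAll)
  suffices h : ∀ a, Nonempty (TM2OutputsInTime (appendProg tm p') (List.map eIn.invFun (ea a))
      (some (List.map (Equiv.refl Bool).invFun (ec (g (f a)))))
      ((time + (T + 13 * .X + 6).comp (.X + .C C * time)).eval (ea a).length)) from
    ⟨⟨⟨appendProg tm p', eIn, .refl Bool⟩, _, fun a => (h a).some⟩⟩
  intro a
  obtain ⟨⟨n, hn⟩, hle⟩ := hout a
  simp only at hn hle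
  set s := List.map eIn.invFun (ea a) with hs
  set w := eb (f a) with hw
  set s' := List.map eOut.invFun w with hs'
  have hmap : s'.map eOut = w := by
    rw [hs', List.map_map]
    exact (List.map_congr_left fun b _ => eOut.apply_symm_apply b).trans (List.map_id w)
  have hlen : s'.length = w.length := by rw [hs', List.length_map]
  have hwlen : w.length ≤ (ea a).length + C * n := by
    have h := length_next_iterate_le hC (n := (ea a).length) (fun k => ?_) hn tm.k₁
    · rw [haltList_stk, update_self, hlen] at h
      exact h
    · rw [initList_stk]
      by_cases hk : k = tm.k₀
      · subst hk
        rw [update_self, hs, List.length_map]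
      · rw [update_of_ne hk]
        exact Nat.zero_le _
  have h₁ := run_distribute tm.k₁ eOut (haltList tm s').stk [] (fun _ => []) (fun _ => []) s'
    (by rw [haltList_stk, update_self])
  rw [haltList_stk, update_idem, update_eq_self_iff.2 rfl, hmap] at h₁
  simp only [List.append_nil] at h₁
  obtain ⟨t, ht, h₂⟩ := hT w (fun _ => []) [] (fun _ => w.reverse) (fun _ => [])
    fun _ _ => ⟨rfl, rfl⟩
  rw [List.append_nil] at h₂
  -- the halting configuration requires that all stacks but the output be empty
  have h₃ := run_clearAll (fun k => ([] : List (tm.Γ k))) (u w) (fun _ => w.reverse) (fun _ => [])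
    w.length (fun _ => by simp)
  rw [← haltList_stk tm s'] at h₁
  have hrun := appendProg_outputs hn (h₁.seq (h₂.seq h₃))
  have hmap' : List.map (Equiv.refl Bool).invFun (ec (g (f a))) = u w := by
    rw [hu]
    exact List.map_id _
  refine ⟨⟨⟨_, hrun.trans ?_⟩, ?_⟩⟩
  · exact congrArg (fun w => some (haltList _ w)) hmap'.symm
  · have h4 := hwlen.trans (Nat.add_le_add_left (Nat.mul_le_mul_left C hle) _)
    have h5 := eval_mono_nat T h4
    simp only [Polynomial.eval_add, Polynomial.eval_comp, Polynomial.eval_mul, Polynomial.eval_C,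
      Polynomial.eval_X, Polynomial.eval_ofNat, hlen]
    omega

end DegreeRealization

namespace DegreeRealization

/-! ### The reduction -/

theorem encodeSequence_append (D E : List ℕ) :
    encodeSequence (D ++ E) = encodeSequence D ++ encodeSequence E :=
  List.flatMap_append

theorem encodeSequence_singleton (d : ℕ) :
    encodeSequence [d] = List.replicate d true ++ [false] := by
  simp [encodeSequence]

theorem flatten_replicate_replicate {A : Type} (n k : ℕ) (a : A) :
    (List.replicate n (List.replicate k a)).flatten = List.replicate (n * k) a := by
  simp

theorem flatten_replicate_encodeSequence (n k d : ℕ) :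
    (List.replicate n (encodeSequence (List.replicate k d))).flatten =
      encodeSequence (List.replicate (n * k) d) := by
  induction n with
  | zero => simp [encodeSequence]
  | succ n ih =>
    rw [List.replicate_succ, List.flatten_cons, ih, ← encodeSequence_append,
      ← List.replicate_add, Nat.succ_mul, add_comm]

/-- In `1^d 0`, replacing the separator `0` by `1^h 0` raises the term `d` by `h`. -/
theorem flatMap_encodeSequence_add (D : List ℕ) (h : ℕ) :
    (encodeSequence D).flatMap (fun a => bif a then [true] else encodeSequence [h]) =
      encodeSequence (D.map (· + h)) := by
  induction D with
  | nil => rfl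
  | cons d D ih =>
    have h₁ : encodeSequence (d :: D) = List.replicate d true ++ (false :: encodeSequence D) := by
      simp [encodeSequence]
    have h₂ : (List.replicate d true).flatMap (fun a => bif a then [true] else encodeSequence [h]) =
        List.replicate d true := by
      rw [List.flatMap_def, List.map_replicate, cond_true, ← List.replicate_one,
        flatten_replicate_replicate, mul_one]
    rw [h₁, List.flatMap_append, List.flatMap_cons, ih, h₂, List.map_cons, cond_false,
      ← List.singleton_append (l := List.map _ _), encodeSequence_append, encodeSequence_singleton,
      encodeSequence_singleton, List.replicate_add]
    simp only [List.append_assoc]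

/-- The letters of the encoding of `D` serve to count the `D.length + 2 * D.sum` terms that bring
the number of terms to twice the length of the encoding. -/
theorem flatMap_encodeSequence_pad (D : List ℕ) (h : ℕ) :
    (encodeSequence D).flatMap
        (fun a => bif a then encodeSequence (List.replicate 2 h)
          else encodeSequence (List.replicate 1 h)) =
      encodeSequence (List.replicate (D.length + 2 * D.sum) h) := by
  induction D with
  | nil => rfl
  | cons d D ih =>
    have h₁ : encodeSequence (d :: D) = List.replicate d true ++ (false :: encodeSequence D) := by
      simp [encodeSequence]
    have h₂ : (List.replicate d true).flatMap (fun a => bif a then encodeSequence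
        (List.replicate 2 h) else encodeSequence (List.replicate 1 h)) =
        encodeSequence (List.replicate (d * 2) h) := by
      rw [← flatten_replicate_encodeSequence, List.flatMap_def, List.map_replicate, cond_true]
    rw [h₁, List.flatMap_append, List.flatMap_cons, ih, h₂, cond_false, ← encodeSequence_append,
      ← encodeSequence_append, ← List.replicate_add, ← List.replicate_add, List.length_cons,
      List.sum_cons]
    congr 2
    ring

section

variable {K : Type} [DecidableEq K] {Γ : K → Type} {X : Set (Fin 4)}
  {p : Prog (K ⊕ Aux) (Alphabet Γ)} {u v : List Bool → List Bool}

theorem Emits.congr (h : Emits X p u) (huv : ∀ w, u w = v w) : Emits X p v := by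
  rwa [← funext huv]

theorem Emits.loop_const {i : Fin 4} (h : Emits X p u) (hi : i ∉ X) :
    Emits (insert i X) (DegreeRealization.loop i p p)
      fun w => (List.replicate w.length (u w)).flatten :=
  (Emits.loop hi h h).congr fun w => by
    simp only [Bool.cond_self, List.flatMap_def, List.map_const']

/-- Two nested loops over the input write a number of ones quadratic in its length. -/
theorem exists_emits_ones {i j : Fin 4} (hij : i ≠ j) (c : ℕ) :
    ∃ p, Emits (Γ := Γ) {i, j} p fun w => List.replicate (c * w.length ^ 2) true := by
  have h := ((((emits_emit (Γ := Γ) (X := ∅) true).repeatProg c).loop_const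
    (Set.notMem_empty j)).loop_const (i := i) (by simpa using hij))
  rw [insert_empty_eq] at h
  refine ⟨_, h.congr fun w => ?_⟩
  rw [← List.replicate_one, flatten_replicate_replicate, flatten_replicate_replicate,
    flatten_replicate_replicate]
  congr 1
  ring

theorem exists_emits_quadratic {i j : Fin 4} (hij : i ≠ j) (c : ℕ) :
    ∃ p, Emits (Γ := Γ) {i, j} p fun w => encodeSequence (List.replicate 1 (c * w.length ^ 2)) := by
  obtain ⟨p, hp⟩ := exists_emits_ones (Γ := Γ) hij c
  exact ⟨_, ((emits_emit false).seq hp).congr fun w => (encodeSequence_singleton _).symm⟩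

theorem exists_emits_quadratic_add {i j : Fin 4} (hij : i ≠ j) (c : ℕ) :
    ∃ p, Emits (Γ := Γ) {i, j} p
      fun w => encodeSequence (List.replicate 1 (w.length + c * w.length ^ 2)) := by
  obtain ⟨p, hp⟩ := exists_emits_ones (Γ := Γ) hij c
  have h := ((emits_emit (Γ := Γ) (X := ∅) true).loop_const (Set.notMem_empty i)).mono
    (Y := {i, j}) (by simp)
  refine ⟨_, ((emits_emit false).seq (hp.seq h)).congr fun w => ?_⟩
  rw [List.replicate_one, encodeSequence_singleton, List.replicate_add, ← List.replicate_one,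
    flatten_replicate_replicate, mul_one]

theorem exists_emits_replicate {a : List Bool → ℕ} (c : ℕ)
    (h : ∃ p, Emits (Γ := Γ) {2, 3} p fun w => encodeSequence (List.replicate 1 (a w))) :
    ∃ p, Emits (Γ := Γ) Set.univ p
      fun w => encodeSequence (List.replicate (c * w.length ^ 2) (a w)) := by
  obtain ⟨p, hp⟩ := h
  have h := ((hp.repeatProg c).loop_const (i := 1) (by simp)).loop_const (i := 0) (by simp)
  refine ⟨_, (h.congr fun w => ?_).mono (Set.subset_univ _)⟩
  rw [flatten_replicate_encodeSequence, flatten_replicate_encodeSequence,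
    flatten_replicate_encodeSequence]
  congr 2
  ring

end

/-- The terms of `amplify`, written as they are computed from the length of the encoding. -/
theorem amplify_eq (o p k : ℕ) (D : List ℕ) : amplify o p k D =
    D.map (· + o * (o + p) * k * (D.length + D.sum) ^ 2) ++
      List.replicate (D.length + 2 * D.sum) (o * (o + p) * k * (D.length + D.sum) ^ 2) ++
      List.replicate (2 * (o * (o + p)) * k * (D.length + D.sum) ^ 2)
        (D.length + D.sum + (o * (o + p) + o * p) * k * (D.length + D.sum) ^ 2) ++
      List.replicate (2 * (p * (o + p)) * k * (D.length + D.sum) ^ 2)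
        (o * o * k * (D.length + D.sum) ^ 2) := by
  simp only [amplify]
  generalize D.length + D.sum = m
  have e₁ : o * (o + p) * (k * m ^ 2) = o * (o + p) * k * m ^ 2 := by ring
  have e₂ : 2 * (o * (o + p)) * k * m ^ 2 = 2 * (o * (o + p) * k * m ^ 2) := by ring
  have e₃ : m + (o * (o + p) + o * p) * k * m ^ 2 =
    o * (o + p) * k * m ^ 2 + m + o * p * (k * m ^ 2) := by ring
  have e₄ : 2 * (p * (o + p)) * k * m ^ 2 = 2 * (p * (o + p) * (k * m ^ 2)) := by ring
  have e₅ : o * o * k * m ^ 2 = o * o * (k * m ^ 2) := by ring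
  rw [e₁, e₂, e₃, e₄, e₅]

section

variable {K : Type} [DecidableEq K] {Γ : K → Type}

theorem exists_emits_amplify (o p k : ℕ) : ∃ P, Emits (Γ := Γ) Set.univ P fun w =>
    w.flatMap (fun a => bif a then [true]
        else encodeSequence (List.replicate 1 (o * (o + p) * k * w.length ^ 2))) ++
      w.flatMap (fun a => bif a then
          encodeSequence (List.replicate 2 (o * (o + p) * k * w.length ^ 2))
        else encodeSequence (List.replicate 1 (o * (o + p) * k * w.length ^ 2))) ++
      encodeSequence (List.replicate (2 * (o * (o + p)) * k * w.length ^ 2)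
        (w.length + (o * (o + p) + o * p) * k * w.length ^ 2)) ++
      encodeSequence (List.replicate (2 * (p * (o + p)) * k * w.length ^ 2)
        (o * o * k * w.length ^ 2)) := by
  obtain ⟨p₁, h₁⟩ := exists_emits_quadratic (Γ := Γ) (i := 1) (j := 2) (by simp) (o * (o + p) * k)
  obtain ⟨p₃, h₃⟩ := exists_emits_replicate (2 * (o * (o + p)) * k)
    (exists_emits_quadratic_add (Γ := Γ) (i := 2) (j := 3) (by simp) ((o * (o + p) + o * p) * k))
  obtain ⟨p₄, h₄⟩ := exists_emits_replicate (2 * (p * (o + p)) * k)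
    (exists_emits_quadratic (Γ := Γ) (i := 2) (j := 3) (by simp) (o * o * k))
  have h₂ := (h₁.seq h₁).congr fun w => (encodeSequence_append _ _).symm
  have ha := (Emits.loop (i := 0) (by simp) h₁ (emits_emit true)).mono (Set.subset_univ _)
  have hb := (Emits.loop (i := 0) (by simp) h₁ h₂).mono (Set.subset_univ _)
  exact ⟨_, h₄.seq (h₃.seq (hb.seq ha))⟩

end

/-- Instances of the restricted problem are encoded as in `BDR`, so a verifier for `BDR` is one for
the restricted problem. -/
theorem DecisionProblem.InNP.bdrBetween (h : BDR.InNP) (c₁ c₂ : ℝ) : (BDRBetween c₁ c₂).InNP := by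
  obtain ⟨verify, q, ⟨M⟩, hq⟩ := h
  exact ⟨fun x => verify (x.1.1, x.2), q,
    ⟨⟨M.toTM2ComputableAux, M.time, fun x => M.outputsFun (x.1.1, x.2)⟩⟩, fun x => hq x.1⟩

end DegreeRealization

theorem mainTheorem2 (hBDR : DegreeRealization.BDR.NPComplete) (c₁ c₂ : ℝ)
    (hc₂_pos : 0 < c₂) (hc₂_lt : c₂ < 1 / 2) (hc₁ : c₁ < 1 - c₂ - √(1 - 2 * c₂)) :
    (DegreeRealization.BDRBetween c₁ c₂).NPComplete := by
  open DegreeRealization in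
  refine ⟨hBDR.1.bdrBetween c₁ c₂, fun L hL => ?_⟩
  obtain ⟨f, hf, hyes⟩ := hBDR.2 L hL
  obtain ⟨o, p, ho, h₁, h₂⟩ := exists_constants hc₂_pos hc₂_lt hc₁
  obtain ⟨k, hk, hbetween⟩ := exists_amplify_between h₁ h₂ hc₂_pos.le
  refine ⟨fun x => ⟨amplify o p k (f x), hbetween (f x)⟩,
    hf.comp_emits
      (g := fun D : List ℕ => (⟨amplify o p k D, hbetween D⟩ : (BDRBetween c₁ c₂).Instance))
      (fun D => ?_) (fun K _ Γ => exists_emits_amplify o p k), fun x => (hyes x).trans ?_⟩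
  · change encodeSequence (amplify o p k D) = _
    simp only [BDR, List.replicate_one, flatMap_encodeSequence_add, encodeSequence_length]
    simp only [← List.replicate_one, flatMap_encodeSequence_pad, ← encodeSequence_append]
    rw [amplify_eq]
  · exact (hasBipartiteRealization_amplify_iff ho hk (f x)).symm
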